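/- Fix a field $k$; $H_i$ denotes singular homology with coefficients in $k$, $i\in\mathbb Z$ (zero for $i<0$). **Definitions.** Let $X$ be a topological space and $g:X\to\mathbb R$. A real number $a$ is a *homological critical value* of $g$ if there is $i\in\mathbb Z$ such that, for all sufficiently small $\varepsilon>0$, the map $H_i(g^{-1}(-\infty,a-\varepsilon])\to H_i(g^{-1}(-\infty,a+\varepsilon])$ induced by inclusion is not an isomorphism. The function $g$ is *tame* if it has finitely many homological critical values and $H_i(g^{-1}(-\infty,a])$ is finite-dimensional for all $i\in\mathbb Z$, $a\in\mathbb R$. A pair $(\vec l,\vec b)\in\mathbb R^n\times\mathbb R^n$ is *admissible* if $\vec l$ is a Euclidean unit vector with $l_j>0$ for all $j$ and $\sum_j b_j=0$. For $\vec f=(f_1,\dots,f_n):X\to\mathbb R^n$ and an admissible pair, the *reduced function* is $P\mapsto\max_{j}\frac{f_j(P)-b_j}{l_j}$. A continuous $\vec f:X\to\mathbb R^n$ is *max-tame* if its reduced function is tame for every admissible pair. The *rank invariant* of $(X,g)$ in degree $i$ is, for real $s<t$, $\rho(s,t)=\operatorname{rank}\bigl(H_i(g^{-1}(-\infty,s])\to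 H_i(g^{-1}(-\infty,t])\bigr)$. The multiplicity of a point $(x,y)$, $x<y<\infty$, is $$\min_{\varepsilon>0,\ x+\varepsilon<y-\varepsilon}\ \rho(x+\varepsilon,y-\varepsilon)-\rho(x-\varepsilon,y-\varepsilon)-\rho(x+\varepsilon,y+\varepsilon)+\rho(x-\varepsilon,y+\varepsilon),$$ and that of $(x,\infty)$ is $\min_{\varepsilon>0,\ t>x+\varepsilon}\ \rho(x+\varepsilon,t)-\rho(x-\varepsilon,t)$. The points of positive multiplicity are the *cornerpoints*. Let $C(\rho)$ be the multiset of cornerpoints, counted with multiplicity, augmented by countably infinitely many points of the diagonal $y=x$. Put $$\delta\bigl((a,b),(c,d)\bigr)=\min\Bigl\{\max\{|a-c|,|b-d|\},\ \max\bigl\{\tfrac{b-a}2,\tfrac{d-c}2\bigr\}\Bigr\}$$ (with $|\infty-\infty|=0$, $|\infty-d|=|d-\infty|=\infty$ for real $d$, $\frac{\infty-a}2=\infty$), and define the *matching (bottleneck) distance* $$d(\rho',\rho'')=\inf_{\sigma}\ \sup_{P\in C(\rho')}\delta(P,\sigma(P))\in[0,\infty],$$ where $\sigma$ runs over all bijections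 $C(\rho')\to C(\rho'')$. **Proposition 4.3.** Let $X$ be a non-empty, compact, locally connected Hausdorff space, let $\vec f',\vec f'':X\to\mathbb R^n$ be max-tame, and let $\epsilon\in\mathbb R$ satisfy $\max_{P\in X}\|\vec f'(P)-\vec f''(P)\|_\infty\le\epsilon$. Then for every admissible pair $(\vec l,\vec b)$ and every $i\in\mathbb Z$, $$d(\rho'_{X,i},\rho''_{X,i})\ \le\ \frac{\epsilon}{\min_{j=1,\dots,n}l_j},$$ where $\rho'_{X,i},\rho''_{X,i}$ are the rank invariants in degree $i$ of $(X,g')$ and $(X,g'')$, and $g',g''$ are the reduced functions of $\vec f',\vec f''$ for $(\vec l,\vec b)$. -/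

import Mathlib

open CategoryTheory

universe u v

noncomputable section

namespace MultiPersistence

/-! ### Admissible pairs and the reduced function -/

/-- `(l, b)` is admissible: `l` is a (Euclidean) unit vector with positive coordinates and the
coordinates of `b` sum to zero. -/
structure Admissible {n : ℕ} (l b : EuclideanSpace ℝ (Fin n)) : Prop where
  norm_eq_one : ‖l‖ = 1
  pos : ∀ j, 0 < l j
  sum_eq_zero : ∑ j, b j = 0

/-- The reduced function `g(P) = max_j (f_j(P) - b_j) / l_j`. (The supremum of a finite nonempty
family of reals is its maximum; there is no admissible pair for `n = 0`.) -/
def reduced {X : Type u} {n : ℕ} (l b : EuclideanSpace ℝ (Fin n)) (f : X → Fin n → ℝ) :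
    X → ℝ :=
  fun P => ⨆ j, (f P j - b j) / l j

/-! ### Persistent homology of a real function -/

/-- The `i`-th singular homology over the field `k`, as a functor, for every integer `i`;
it is zero in negative degrees. -/
def singularHomology (k : Type v) [Field k] (i : ℤ) :
    TopCat.{u} ⥤ ModuleCat.{max u v} k :=
  match i with
  | Int.ofNat m =>
      (AlgebraicTopology.singularHomologyFunctor.{u} (ModuleCat.{max u v} k) m).obj
        (ModuleCat.of k (ULift.{u} k))
  | Int.negSucc _ => (Functor.const _).obj (ModuleCat.of k PUnit)

/-- The lower level set `{P | f P ≤ a}`, with the subspace topology. -/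
abbrev lowerLevel {X : Type u} [TopologicalSpace X] (f : X → ℝ) (a : ℝ) : TopCat.{u} :=
  TopCat.of {P : X // f P ≤ a}

/-- The inclusion of the lower level set of `s` in that of `t`. -/
def lowerLevelIncl {X : Type u} [TopologicalSpace X] (f : X → ℝ) {s t : ℝ} (h : s ≤ t) :
    lowerLevel f s ⟶ lowerLevel f t :=
  TopCat.ofHom
    { toFun := fun P => ⟨P.1, P.2.trans h⟩
      continuous_toFun := by fun_prop }

/-- The linear map `H_i(f ≤ s) → H_i(f ≤ t)` induced by inclusion. -/
def persistenceMap (k : Type v) [Field k] {X : Type u} [TopologicalSpace X] (f : X → ℝ) (i : ℤ)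
    {s t : ℝ} (h : s ≤ t) :
    (singularHomology.{u, v} k i).obj (lowerLevel f s) →ₗ[k]
      (singularHomology.{u, v} k i).obj (lowerLevel f t) :=
  ((singularHomology.{u, v} k i).map (lowerLevelIncl f h)).hom

/-- `a` is a homological critical value of `f`: for some degree `i` and all sufficiently small
`ε > 0` the map `H_i(f ≤ a - ε) → H_i(f ≤ a + ε)` is not an isomorphism. -/
def IsHomologicalCriticalValue (k : Type v) [Field k] {X : Type u} [TopologicalSpace X]
    (f : X → ℝ) (a : ℝ) : Prop :=
  ∃ i : ℤ, ∃ ε₀ : ℝ, 0 < ε₀ ∧ ∀ (ε : ℝ) (hε : 0 < ε), ε < ε₀ →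
    ¬ Function.Bijective
      (persistenceMap k f i (show a - ε ≤ a + ε by linarith))

/-- `f` is tame: it has finitely many homological critical values, and all the homology modules
of its lower level sets are finite-dimensional. -/
structure Tame (k : Type v) [Field k] {X : Type u} [TopologicalSpace X] (f : X → ℝ) : Prop where
  finite_critical : {a : ℝ | IsHomologicalCriticalValue k f a}.Finite
  finite_dimensional : ∀ (i : ℤ) (a : ℝ),
    FiniteDimensional k ((singularHomology.{u, v} k i).obj (lowerLevel f a))

/-- `f : X → ℝⁿ` is max-tame: it is continuous and all its reduced functions are tame. -/
structure MaxTame (k : Type v) [Field k] {X : Type u} [TopologicalSpace X] {n : ℕ}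
    (f : X → Fin n → ℝ) : Prop where
  continuous : Continuous f
  tame : ∀ l b : EuclideanSpace ℝ (Fin n), Admissible l b → Tame k (reduced l b f)

/-! ### Rank invariants, cornerpoints and the matching distance -/

/-- The open half-plane `Δ⁺ = {(s, t) | s < t}`. -/
abbrev DeltaPlus : Type := {p : ℝ × ℝ // p.1 < p.2}

/-- The rank invariant of `(X, g)` in degree `i`: the rank of the image of
`H_i(g ≤ s) → H_i(g ≤ t)`, for `s < t`. -/
def rankInvariant (k : Type v) [Field k] {X : Type u} [TopologicalSpace X] (g : X → ℝ) (i : ℤ) :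
    DeltaPlus → ℕ :=
  fun p => Module.finrank k (LinearMap.range (persistenceMap k g i p.2.le))

/-- The multiplicity of a proper point `(x, y)`: the minimum over all `ε > 0` with
`x + ε < y - ε` of
`ρ(x + ε, y - ε) - ρ(x - ε, y - ε) - ρ(x + ε, y + ε) + ρ(x - ε, y + ε)`.
These alternating sums are nonnegative for a rank invariant. If `y ≤ x` there is no such `ε`
and the value is `0`. -/
def properMultiplicity (ρ : DeltaPlus → ℕ) (x y : ℝ) : ℕ :=
  sInf {m : ℕ | ∃ (ε : ℝ) (hε : 0 < ε) (h : x + ε < y - ε),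
    (m : ℤ) =
      ρ ⟨(x + ε, y - ε), h⟩
      - ρ ⟨(x - ε, y - ε), show x - ε < y - ε by linarith⟩
      - ρ ⟨(x + ε, y + ε), show x + ε < y + ε by linarith⟩
      + ρ ⟨(x - ε, y + ε), show x - ε < y + ε by linarith⟩}

/-- The multiplicity of a point at infinity `(x, ∞)`: the minimum over all `ε > 0` and all
`t > x + ε` of `ρ(x + ε, t) - ρ(x - ε, t)`, a nonnegative number for a rank invariant. -/
def infiniteMultiplicity (ρ : DeltaPlus → ℕ) (x : ℝ) : ℕ :=
  sInf {m : ℕ | ∃ (ε t : ℝ) (hε : 0 < ε) (h : x + ε < t),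
    (m : ℤ) = ρ ⟨(x + ε, t), h⟩ - ρ ⟨(x - ε, t), show x - ε < t by linarith⟩}

/-- Points `(x, y)` of the extended plane, with `x` real and `y` real or `∞`. -/
abbrev ExtPoint : Type := ℝ × WithTop ℝ

/-- The multiplicity of a point of the extended plane as a cornerpoint of `ρ`; the cornerpoints
are the points of positive multiplicity. -/
def multiplicity (ρ : DeltaPlus → ℕ) : ExtPoint → ℕ
  | (x, ⊤) => infiniteMultiplicity ρ x
  | (x, WithTop.some y) => properMultiplicity ρ x y

/-- The persistence diagram of `ρ` as an index type: every cornerpoint occurs as often as its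
multiplicity says, and countably infinitely many points of the diagonal are added (those with
rational coordinates; as any diagonal point is at the same `pointDist` from a given point, it is
immaterial which ones). -/
abbrev Diagram (ρ : DeltaPlus → ℕ) : Type :=
  (Σ p : ExtPoint, Fin (multiplicity ρ p)) ⊕ ℚ

/-- The point of the extended plane that an element of the persistence diagram stands for. -/
def Diagram.point {ρ : DeltaPlus → ℕ} : Diagram ρ → ExtPoint
  | Sum.inl c => c.1
  | Sum.inr q => ((q : ℝ), ((q : ℝ) : WithTop ℝ))

/-- `|b - d|` for `b, d ∈ (-∞, ∞]`, with `|∞ - ∞| = 0` and `|∞ - d| = ∞` for real `d`. -/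
def extAbsSub : WithTop ℝ → WithTop ℝ → ENNReal
  | ⊤, ⊤ => 0
  | ⊤, WithTop.some _ => ⊤
  | WithTop.some _, ⊤ => ⊤
  | WithTop.some b, WithTop.some d => ENNReal.ofReal |b - d|

/-- `(b - a) / 2` for the point `(a, b)` of the extended plane, `a ≤ b ≤ ∞`. -/
def halfPersistence : ExtPoint → ENNReal
  | (_, ⊤) => ⊤
  | (a, WithTop.some b) => ENNReal.ofReal ((b - a) / 2)

/-- `δ((a,b),(c,d)) = min { max {|a-c|, |b-d|}, max {(b-a)/2, (d-c)/2} }`. -/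
def pointDist (p q : ExtPoint) : ENNReal :=
  min (max (ENNReal.ofReal |p.1 - q.1|) (extAbsSub p.2 q.2))
    (max (halfPersistence p) (halfPersistence q))

/-- The matching (bottleneck) distance of two rank invariants: the infimum, over all bijections
`σ` between their persistence diagrams, of the supremum of `δ(P, σ(P))`. -/
def matchingDistance (ρ₁ ρ₂ : DeltaPlus → ℕ) : ENNReal :=
  ⨅ σ : Diagram ρ₁ ≃ Diagram ρ₂, ⨆ P : Diagram ρ₁, pointDist P.point (σ P).point

end MultiPersistence

end

universe w

noncomputable section

namespace MultiPersistence

/-! ### Homology of the empty space -/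

/-! Reduced functions of uniformly `ε`-close maps are uniformly `η`-close with `η = ε / min l`.
Hence their sublevel sets are nested up to a shift by `η`, and functoriality of homology makes the
two persistence modules `η`-interleaved. It remains to prove algebraic stability for such modules.

Barcodes. Tameness says nothing about one-sided continuity, and even at a regular value the homology
of the sublevel set may be exceptional. Ranks between different indices are nevertheless constant on
the cells cut out by the critical values, and generic points, at which the dimension equals that
rank, are dense. Transition maps between generic points of one cell are isomorphisms. So one generic
point per cell gives a finite persistence module, which splits into intervals. The generators and
dual functionals extend to the real line, and since any `s < t` have a generic point between them,
they describe every map `V s → V t`. The alternating sums of ranks then count bars.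

Matching. For `θ > η`, the coefficients of the two interleaving maps between bars form two matrices
whose product is the identity where the bars are long enough. If bars are ordered by birth plus
death, discarding the columns of bars that are not `θ`-close to one of the given long bars keeps the
product unitriangular. This gives independent rows, hence Hall's condition (`card_le_card_close`):
long bars inject into close bars, and short bars go to the diagonal. Doing this both ways, a
Schröder–Bernstein argument yields a bijection with cost at most `θ`; finally `θ → η`. -/

theorem subsingleton_singularHomology_of_isEmpty (k : Type v) [Field k] (i : ℤ) (Y : TopCat.{u})
    [IsEmpty Y] : Subsingleton ((singularHomology.{u, v} k i).obj Y) := by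
  match i with
  | Int.negSucc _ =>
    change Subsingleton PUnit
    infer_instance
  | Int.ofNat m =>
    change Subsingleton (((AlgebraicTopology.singularHomologyFunctor.{u} (ModuleCat.{max u v} k) m).obj
        (ModuleCat.of k (ULift.{u} k))).obj Y)
    apply ModuleCat.subsingleton_of_isZero
    -- The empty space is totally disconnected, so its homology sits in degree 0, where it is a
    -- coproduct over no points.
    by_cases hm : m = 0
    · subst hm
      refine Limits.IsZero.of_iso ?_
        (AlgebraicTopology.singularHomologyFunctorZeroOfTotallyDisconnectedSpace _ _ Y)
      rw [Limits.IsZero.iff_id_eq_zero]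
      exact Limits.Sigma.hom_ext _ _ fun y => isEmptyElim y
    · exact AlgebraicTopology.isZero_singularHomologyFunctor_of_totallyDisconnectedSpace _ m _ Y hm

/-! ### Persistence modules -/

/-- A persistence module over a field, indexed by a preorder. -/
structure PersistenceModule (k : Type v) [Field k] (P : Type*) [Preorder P] where
  /-- The vector space at an index. -/
  V : P → Type w
  [addCommGroup : ∀ t, AddCommGroup (V t)]
  [module : ∀ t, Module k (V t)]
  /-- The transition map. -/
  map : ∀ {s t}, s ≤ t → V s →ₗ[k] V t
  map_refl : ∀ t (v : V t), map (le_refl t) v = v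
  map_map : ∀ {r s t} (h : r ≤ s) (h' : s ≤ t) (v : V r), map h' (map h v) = map (h.trans h') v

namespace PersistenceModule

attribute [instance] addCommGroup module

attribute [simp] map_refl map_map

variable {k : Type v} [Field k]

/-- The decomposition of a persistence module over a linear order as a direct sum of interval
modules `[birth, death]`, given by generators and dual functionals. -/
structure IntervalDecomposition {P : Type*} [LinearOrder P]
    (F : PersistenceModule.{v, w} k P) where
  /-- The index type of the intervals. -/
  ι : Type
  [fintype : Fintype ι]
  birth : ι → P
  death : ι → P
  /-- The generator of an interval. -/
  gen : ι → ∀ p, F.V p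
  /-- The coordinate along an interval. -/
  coord : ι → ∀ p, F.V p →ₗ[k] k
  birth_le_death : ∀ I, birth I ≤ death I
  map_gen : ∀ I {p q} (h : p ≤ q), birth I ≤ p → F.map h (gen I p) = gen I q
  coord_map : ∀ I {p q} (h : p ≤ q), q ≤ death I → ∀ v, coord I q (F.map h v) = coord I p v
  gen_eq_zero : ∀ I {p}, death I < p → gen I p = 0
  coord_eq_zero : ∀ I {p}, p < birth I → coord I p = 0
  coord_gen_self : ∀ I {p}, birth I ≤ p → p ≤ death I → coord I p (gen I p) = 1
  coord_gen_of_ne : ∀ {I K}, I ≠ K → ∀ {p}, birth I ≤ p → p ≤ death K → coord K p (gen I p) = 0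
  sum_coord : ∀ p v, ∑ I, coord I p v • gen I p = v

/-- A generator of a persistence module and a functional dual to it split off an interval. -/
structure Splitting {P : Type*} [LinearOrder P] (F : PersistenceModule.{v, w} k P) where
  birth : P
  death : P
  /-- The generator. -/
  gen : ∀ p, F.V p
  /-- The dual functional. -/
  coord : ∀ p, F.V p →ₗ[k] k
  birth_le_death : birth ≤ death
  map_gen : ∀ {p q} (h : p ≤ q), birth ≤ p → F.map h (gen p) = gen q
  coord_map : ∀ {p q} (h : p ≤ q), q ≤ death → ∀ v, coord q (F.map h v) = coord p v
  gen_eq_zero : ∀ {p}, death < p → gen p = 0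
  coord_eq_zero : ∀ {p}, p < birth → coord p = 0
  coord_eq_zero_of_death : ∀ {p}, death < p → coord p = 0
  map_eq_zero : ∀ {p q} (h : p ≤ q), p < birth → F.map h = 0
  coord_gen : ∀ {p}, birth ≤ p → p ≤ death → coord p (gen p) = 1

namespace Splitting

variable {P : Type*} [LinearOrder P] {F : PersistenceModule.{v, w} k P} (S : Splitting F)

theorem coord_sub (p : P) (v : F.V p) : S.coord p (v - S.coord p v • S.gen p) = 0 := by
  rcases lt_or_ge p S.birth with h | h
  · simp [S.coord_eq_zero h]
  rcases lt_or_ge S.death p with h' | h'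
  · simp [S.coord_eq_zero_of_death h']
  simp [S.coord_gen h h']

theorem map_mem_ker {p q : P} (h : p ≤ q) (v : F.V p) (hv : v ∈ LinearMap.ker (S.coord p)) :
    F.map h v ∈ LinearMap.ker (S.coord q) := by
  rw [LinearMap.mem_ker] at hv ⊢
  rcases lt_or_ge S.death q with h' | h'
  · simp [S.coord_eq_zero_of_death h']
  rw [S.coord_map h h', hv]

/-- The complement of the interval that is split off. -/
def compl : PersistenceModule.{v, w} k P where
  V p := LinearMap.ker (S.coord p)
  map {_ _} h := (F.map h).restrict (S.map_mem_ker h)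
  map_refl t v := by ext; simp
  map_map h h' v := by ext; simp

/-- The projection to the complement. -/
def proj (p : P) : F.V p →ₗ[k] S.compl.V p :=
  LinearMap.codRestrict (LinearMap.ker (S.coord p))
    (LinearMap.id - (S.coord p).smulRight (S.gen p)) fun v => by
      simpa using S.coord_sub p v

theorem coe_proj (p : P) (v : F.V p) :
    (S.proj p v).1 = v - S.coord p v • S.gen p := rfl

/-- Before the birth this needs `map_eq_zero`: a vector mapped into the interval from outside could
acquire a nonzero coordinate there. -/
theorem proj_map {p q : P} (h : p ≤ q) (v : F.V p) :
    S.proj q (F.map h v) = S.compl.map h (S.proj p v) := by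
  apply Subtype.ext
  change (S.proj q (F.map h v)).1 = F.map h (S.proj p v).1
  rw [coe_proj, coe_proj, map_sub, map_smul]
  congr 1
  rcases lt_or_ge p S.birth with hb | hb
  · simp [S.map_eq_zero h hb, S.coord_eq_zero hb]
  rw [S.map_gen h hb]
  rcases lt_or_ge S.death q with h' | h'
  · simp [S.gen_eq_zero h']
  rw [S.coord_map h h']

theorem proj_coe (p : P) (v : S.compl.V p) : S.proj p v.1 = v := by
  apply Subtype.ext
  rw [coe_proj, (show S.coord p v.1 = 0 from v.2)]
  simp

theorem proj_gen {p : P} (h : S.birth ≤ p) : S.proj p (S.gen p) = 0 := by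
  apply Subtype.ext
  rw [coe_proj]
  rcases lt_or_ge S.death p with h' | h'
  · rw [S.gen_eq_zero h', smul_zero, sub_zero]
    rfl
  · rw [S.coord_gen h h', one_smul, sub_self]
    rfl

/-- An interval decomposition of the complement extends to the whole module. -/
def extend (D : IntervalDecomposition S.compl) : IntervalDecomposition F :=
  letI := D.fintype
  { ι := Option D.ι
    birth := fun I => I.elim S.birth D.birth
    death := fun I => I.elim S.death D.death
    gen := fun I p => I.elim (S.gen p) fun J => (D.gen J p).1
    coord := fun I p => I.elim (S.coord p) fun J => D.coord J p ∘ₗ S.proj p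
    birth_le_death := by
      rintro (_ | I)
      exacts [S.birth_le_death, D.birth_le_death I]
    map_gen := by
      rintro (_ | I) p q h hb
      exacts [S.map_gen h hb, congrArg Subtype.val (D.map_gen I h hb)]
    coord_map := by
      rintro (_ | I) p q h hd v
      · exact S.coord_map h hd v
      · change D.coord I q (S.proj q (F.map h v)) = D.coord I p (S.proj p v)
        rw [proj_map]
        exact D.coord_map I h hd _
    gen_eq_zero := by
      rintro (_ | I) p h
      exacts [S.gen_eq_zero h, congrArg Subtype.val (D.gen_eq_zero I h)]
    coord_eq_zero := by
      rintro (_ | I) p h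
      · exact S.coord_eq_zero h
      · change D.coord I p ∘ₗ S.proj p = 0
        rw [D.coord_eq_zero I h, LinearMap.zero_comp]
    coord_gen_self := by
      rintro (_ | I) p h h'
      · exact S.coord_gen h h'
      · change D.coord I p (S.proj p (D.gen I p).1) = 1
        rw [proj_coe]
        exact D.coord_gen_self I h h'
    coord_gen_of_ne := by
      rintro (_ | I) (_ | K) hne p h h'
      · exact absurd rfl hne
      · change D.coord K p (S.proj p (S.gen p)) = 0
        rw [S.proj_gen h, map_zero]
      · exact (D.gen I p).2
      · change D.coord K p (S.proj p (D.gen I p).1) = 0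
        rw [proj_coe]
        exact D.coord_gen_of_ne (fun e => hne (congrArg some e)) h h'
    sum_coord := by
      intro p v
      have h := congrArg (LinearMap.ker (S.coord p)).subtype (D.sum_coord p (S.proj p v))
      have h' : ∑ I, D.coord I p (S.proj p v) • (D.gen I p).1 = v - S.coord p v • S.gen p :=
        ((map_sum (LinearMap.ker (S.coord p)).subtype _ _).symm.trans h :)
      rw [Fintype.sum_option]
      exact (congrArg (S.coord p v • S.gen p + ·) h').trans (add_sub_cancel _ _) }

end Splitting

variable {P : Type*} [LinearOrder P]

/-- A nonzero persistence module over a finite linear order has a splitting. -/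
theorem exists_splitting [Finite P] (F : PersistenceModule.{v, w} k P) (p : P)
    (hp : Nontrivial (F.V p)) : ∃ S : Splitting F, Nontrivial (F.V S.birth) := by
  -- Start at the first nonzero space, so that nothing maps into the interval from the left, and
  -- follow a nonzero vector `v` as far as it survives. A functional equal to 1 on its last nonzero
  -- image, pulled back along the transition maps, is the dual coordinate.
  obtain ⟨a, ha, hmin⟩ := (Set.toFinite {p : P | Nontrivial (F.V p)}).exists_minimal ⟨p, hp⟩
  have hlt : ∀ q, q < a → Subsingleton (F.V q) := fun q hq => by
    rw [← not_nontrivial_iff_subsingleton]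
    exact fun h => hq.not_ge (hmin h hq.le)
  have ha' : Nontrivial (F.V a) := ha
  obtain ⟨v, hv⟩ := exists_ne (0 : F.V a)
  obtain ⟨b, ⟨hab, hb⟩, hmax⟩ :=
    (Set.toFinite {q : P | ∃ h : a ≤ q, F.map h v ≠ 0}).exists_maximal
      ⟨a, le_rfl, by simpa using hv⟩
  have hgt : ∀ q (h : a ≤ q), b < q → F.map h v = 0 := fun q h hq => by
    by_contra hne
    exact hq.not_ge (hmax ⟨h, hne⟩ hq.le)
  obtain ⟨f₀, hf₀⟩ : ∃ f : F.V b →ₗ[k] k, f (F.map hab v) ≠ 0 := by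
    by_contra! h
    exact hb ((Module.forall_dual_apply_eq_zero_iff k _).1 h)
  obtain ⟨f, hf⟩ : ∃ f : F.V b →ₗ[k] k, f (F.map hab v) = 1 :=
    ⟨(f₀ (F.map hab v))⁻¹ • f₀, by simp [hf₀]⟩
  refine ⟨{ birth := a, death := b
            gen := fun p => if h : a ≤ p then F.map h v else 0
            coord := fun p => if h : a ≤ p ∧ p ≤ b then f ∘ₗ F.map h.2 else 0
            birth_le_death := hab
            map_gen := ?_, coord_map := ?_, gen_eq_zero := ?_, coord_eq_zero := ?_
            coord_eq_zero_of_death := ?_, map_eq_zero := ?_, coord_gen := ?_ }, ha⟩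
  · intro p q h hp
    simp [hp, hp.trans h]
  · intro p q h hq w
    by_cases hp : a ≤ p
    · simp [hp, hp.trans h, hq, h.trans hq]
    · have := hlt p (not_le.1 hp)
      simp [Subsingleton.elim w 0]
  · intro p hp
    simp [hab.trans hp.le, hgt p _ hp]
  · intro p hp
    simp [hp.not_ge]
  · intro p hp
    simp [hp.not_ge]
  · intro p q h hp
    have := hlt p hp
    ext w
    simp [Subsingleton.elim w 0]
  · intro p hp hp'
    simp [hp, hp', hf]

/-- Induction on the total dimension: passing to the complement of a split interval lowers the
dimension at the birth of the interval. -/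
theorem nonempty_intervalDecomposition [Finite P] (F : PersistenceModule.{v, w} k P)
    (hF : ∀ p, FiniteDimensional k (F.V p)) : Nonempty (IntervalDecomposition F) := by
  have := Fintype.ofFinite P
  induction hN : ∑ p, Module.finrank k (F.V p) using Nat.strong_induction_on generalizing F with
  | _ N ih =>
    by_cases h : ∃ p, Nontrivial (F.V p)
    · obtain ⟨p, hp⟩ := h
      obtain ⟨S, hS⟩ := F.exists_splitting p hp
      have hfd : ∀ p, FiniteDimensional k (S.compl.V p) := fun p =>
        inferInstanceAs (FiniteDimensional k (LinearMap.ker (S.coord p)))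
      obtain ⟨D⟩ := ih _ (by
        rw [← hN]
        refine Finset.sum_lt_sum (fun p _ => Submodule.finrank_le (LinearMap.ker (S.coord p)))
          ⟨S.birth, Finset.mem_univ _, Submodule.finrank_lt ?_⟩
        intro htop
        have h1 := S.coord_gen le_rfl S.birth_le_death
        rw [LinearMap.ker_eq_top.1 htop] at h1
        simp at h1) S.compl hfd rfl
      exact ⟨S.extend D⟩
    · have hs : ∀ p, Subsingleton (F.V p) := fun p =>
        not_nontrivial_iff_subsingleton.1 fun hp => h ⟨p, hp⟩
      exact ⟨{ ι := Empty, birth := Empty.elim, death := Empty.elim, gen := fun I => I.elim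
               coord := fun I => I.elim, birth_le_death := fun I => I.elim
               map_gen := fun I => I.elim, coord_map := fun I => I.elim
               gen_eq_zero := fun I => I.elim, coord_eq_zero := fun I => I.elim
               coord_gen_self := fun I => I.elim, coord_gen_of_ne := fun {I} => I.elim
               sum_coord := fun p v => Subsingleton.elim _ _ }⟩

end PersistenceModule

/-! ### Monotone functions without jumps, and cells of the complement of a finite set -/

/-- A natural-valued antitone function on a ray that takes equal values at suitable points
arbitrarily close to, and on either side of, every point of an interval is constant there. -/
theorem le_of_antitoneOn_of_no_jump {f : ℝ → ℕ} {x y y' : ℝ} (hxy : x < y) (hyy' : y ≤ y')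
    (hf : ∀ s t, x < s → s ≤ t → f t ≤ f s)
    (hjump : ∀ a, y ≤ a → a ≤ y' → ∀ ε₀ > 0, ∃ ε, 0 < ε ∧ ε < ε₀ ∧
      (x < a - ε → f (a - ε) ≤ f (a + ε))) : f y ≤ f y' := by
  by_contra! hlt
  set Z : Set ℝ := {t | y ≤ t ∧ t ≤ y' ∧ f y ≤ f t} with hZ
  have hyZ : y ∈ Z := ⟨le_rfl, hyy', le_rfl⟩
  have hbdd : BddAbove Z := ⟨y', fun t ht => ht.2.1⟩
  have h1 : y ≤ sSup Z := le_csSup hbdd hyZ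
  have h2 : sSup Z ≤ y' := csSup_le ⟨y, hyZ⟩ fun t ht => ht.2.1
  -- The last point at which the value `f y` is still attained cannot be a jump, so the value
  -- persists beyond it. The bound `sSup Z - x` keeps the left sample point inside the ray.
  obtain ⟨ε, hε, hε', h⟩ := hjump (sSup Z) h1 h2 (sSup Z - x) (by linarith)
  have h3 := h (by linarith)
  obtain ⟨z, hz, hz'⟩ := exists_lt_of_lt_csSup ⟨y, hyZ⟩ (show sSup Z - ε < sSup Z by linarith)
  have h4 : f y ≤ f (sSup Z + ε) :=
    hz.2.2.trans ((hf _ _ (by linarith) hz'.le).trans h3)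
  rcases le_or_gt (sSup Z + ε) y' with h5 | h5
  · have := le_csSup hbdd (show sSup Z + ε ∈ Z from ⟨by linarith, h5, h4⟩)
    linarith
  · exact hlt.not_ge (h4.trans (hf _ _ (by linarith) h5.le))

/-- The points of a finite set other than `x` stay away from `x`. -/
theorem exists_gap (C : Finset ℝ) (x : ℝ) : ∃ δ > 0, ∀ c ∈ C, c = x ∨ c < x - δ ∨ x + δ < c := by
  induction C using Finset.induction_on with
  | empty => exact ⟨1, one_pos, by simp⟩
  | insert a s _ ih =>
    obtain ⟨δ, hδ, h⟩ := ih
    by_cases hax : a = x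
    · refine ⟨δ, hδ, fun c hc => ?_⟩
      rcases Finset.mem_insert.1 hc with rfl | hc
      exacts [Or.inl hax, h c hc]
    · have hpos : 0 < |a - x| := abs_pos.2 (sub_ne_zero.2 hax)
      refine ⟨min δ (|a - x| / 2), by positivity, fun c hc => ?_⟩
      have h1 := min_le_left δ (|a - x| / 2)
      have h2 := min_le_right δ (|a - x| / 2)
      rcases Finset.mem_insert.1 hc with rfl | hc
      · right
        rcases abs_cases (c - x) with h3 | h3
        · right; linarith
        · left; linarith
      · rcases h c hc with h | h | h
        · exact Or.inl h
        · right; left; linarith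
        · right; right; linarith

/-- Two reals lie in the same component of the complement of `C`. -/
def SameCell (C : Finset ℝ) (s t : ℝ) : Prop :=
  ∀ c ∈ C, c < s ∧ c < t ∨ s < c ∧ t < c

namespace SameCell

variable {C : Finset ℝ} {r s t : ℝ}

theorem symm (h : SameCell C s t) : SameCell C t s := fun c hc => by
  rcases h c hc with h | h
  exacts [Or.inl h.symm, Or.inr h.symm]

theorem trans (h : SameCell C r s) (h' : SameCell C s t) : SameCell C r t := fun c hc => by
  rcases h c hc with h | h <;> rcases h' c hc with h' | h'
  · exact Or.inl ⟨h.1, h'.2⟩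
  · linarith [h.2, h'.1]
  · linarith [h.2, h'.1]
  · exact Or.inr ⟨h.1, h'.2⟩

theorem notMem (h : SameCell C s t) : s ∉ C := fun hs => by
  rcases h s hs with h | h <;> exact lt_irrefl _ h.1

theorem refl (h : s ∉ C) : SameCell C s s := fun c hc => by
  rcases lt_trichotomy c s with h' | rfl | h'
  exacts [Or.inl ⟨h', h'⟩, absurd hc h, Or.inr ⟨h', h'⟩]

theorem mono_left (h : SameCell C r t) (hrs : r ≤ s) (hst : s ≤ t) : SameCell C s t :=
  fun c hc => by
    rcases h c hc with h | h
    exacts [Or.inl ⟨by linarith [h.1], h.2⟩, Or.inr ⟨by linarith [h.2], h.2⟩]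

theorem max_left (h : SameCell C s t) : SameCell C s (max s t) := by
  rcases le_total s t with h' | h'
  · rwa [max_eq_right h']
  · rw [max_eq_left h']
    exact refl h.notMem

theorem max_right (h : SameCell C s t) : SameCell C t (max s t) := by
  rw [max_comm]
  exact h.symm.max_left

end SameCell

/-! ### Ranks of transition maps and constructible modules -/

namespace PersistenceModule

variable {k : Type v} [Field k]

section Rank

variable {P : Type*} [LinearOrder P] (F : PersistenceModule.{v, w} k P)

/-- The rank of a transition map of a persistence module. -/
def rank (s t : P) : ℕ :=
  if h : s ≤ t then Module.finrank k (LinearMap.range (F.map h)) else 0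

theorem rank_eq {s t : P} (h : s ≤ t) :
    F.rank s t = Module.finrank k (LinearMap.range (F.map h)) := dif_pos h

theorem map_comp {r s t : P} (h : r ≤ s) (h' : s ≤ t) :
    F.map h' ∘ₗ F.map h = F.map (h.trans h') := LinearMap.ext fun v => F.map_map h h' v

variable {F} (hF : ∀ t, FiniteDimensional k (F.V t))

include hF

theorem rank_anti_right {r s t : P} (h : r ≤ s) (h' : s ≤ t) : F.rank r t ≤ F.rank r s := by
  rw [F.rank_eq h, F.rank_eq (h.trans h'), ← F.map_comp h h', LinearMap.range_comp]
  exact Submodule.finrank_map_le _ _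

theorem rank_mono_left {r s t : P} (h : r ≤ s) (h' : s ≤ t) : F.rank r t ≤ F.rank s t := by
  rw [F.rank_eq h', F.rank_eq (h.trans h'), ← F.map_comp h h']
  exact Submodule.finrank_mono (LinearMap.range_comp_le_range _ _)

/-- Frobenius' rank inequality. -/
theorem rank_add_rank_le {a b c d : P} (hab : a ≤ b) (hbc : b ≤ c) (hcd : c ≤ d) :
    F.rank a c + F.rank b d ≤ F.rank b c + F.rank a d := by
  -- The map loses at most as much dimension on `U` as on `V`, because its kernel on `U` is
  -- contained in its kernel on `V`.
  have key : ∀ (U V : Submodule k (F.V c)), U ≤ V →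
      Module.finrank k U + Module.finrank k (V.map (F.map hcd)) ≤
      Module.finrank k V + Module.finrank k (U.map (F.map hcd)) := by
    intro U V hUV
    have h1 := LinearMap.finrank_range_add_finrank_ker ((F.map hcd).domRestrict U)
    have h2 := LinearMap.finrank_range_add_finrank_ker ((F.map hcd).domRestrict V)
    rw [LinearMap.range_domRestrict] at h1 h2
    have h3 : Module.finrank k (LinearMap.ker ((F.map hcd).domRestrict U)) ≤
        Module.finrank k (LinearMap.ker ((F.map hcd).domRestrict V)) := by
      refine LinearMap.finrank_le_finrank_of_injective
        (f := (Submodule.inclusion hUV).restrict fun x hx => ?_) ?_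
      · simpa using hx
      · intro x y hxy
        have := congrArg (fun z => (z.1.1 : F.V c)) hxy
        exact Subtype.ext (Subtype.ext this)
    omega
  have := key (LinearMap.range (F.map (hab.trans hbc))) (LinearMap.range (F.map hbc)) (by
    rw [← F.map_comp hab hbc]
    exact LinearMap.range_comp_le_range _ _)
  rw [← LinearMap.range_comp, ← LinearMap.range_comp, F.map_comp, F.map_comp] at this
  rw [F.rank_eq hbc, F.rank_eq (hab.trans hbc), F.rank_eq (hbc.trans hcd),
    F.rank_eq ((hab.trans hbc).trans hcd)]
  exact this

end Rank

/-- A persistence module over the reals is constructible with respect to the finite set `C` if it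
is pointwise finite-dimensional, vanishes far to the left, and has no (homological) critical values
outside `C`. -/
structure IsConstructible (F : PersistenceModule.{v, w} k ℝ) (C : Finset ℝ) : Prop where
  finiteDimensional : ∀ t, FiniteDimensional k (F.V t)
  regular : ∀ a ∉ C, ∀ ε₀ > 0, ∃ (ε : ℝ) (hε : 0 < ε), ε < ε₀ ∧
    Function.Bijective (F.map (show a - ε ≤ a + ε by linarith))
  subsingleton : ∃ T, ∀ t < T, Subsingleton (F.V t)

namespace IsConstructible

variable {F : PersistenceModule.{v, w} k ℝ} {C : Finset ℝ} (hF : F.IsConstructible C)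

include hF

/-- At a regular value, composing with an injective map across it leaves the rank unchanged, so the
rank has no jump there. -/
theorem rank_eq_of_sameCell_right {x y y' : ℝ} (hxy : x < y) (hyy' : y ≤ y')
    (h : SameCell C y y') : F.rank x y = F.rank x y' := by
  refine le_antisymm ?_ (rank_anti_right hF.finiteDimensional hxy.le hyy')
  refine le_of_antitoneOn_of_no_jump (f := fun t => F.rank x t) hxy hyy'
    (fun s t hs hst => rank_anti_right hF.finiteDimensional hs.le hst) fun a ha ha' ε₀ hε₀ => ?_
  obtain ⟨ε, hε, hε', hb⟩ := hF.regular a (h.mono_left ha ha').notMem ε₀ hε₀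
  refine ⟨ε, hε, hε', fun hx => ?_⟩
  rw [F.rank_eq hx.le, F.rank_eq (show x ≤ a + ε by linarith),
    ← F.map_comp hx.le (show a - ε ≤ a + ε by linarith), LinearMap.range_comp,
    (Submodule.equivMapOfInjective _ hb.1 _).finrank_eq]

theorem rank_eq_of_sameCell_left {x x' y : ℝ} (hxy : x' < y) (hxx' : x ≤ x')
    (h : SameCell C x x') : F.rank x y = F.rank x' y := by
  refine le_antisymm (rank_mono_left hF.finiteDimensional hxx' hxy.le) ?_
  -- Reflecting the line makes the rank antitone in its left index; now surjectivity across a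
  -- regular value excludes a jump.
  have := le_of_antitoneOn_of_no_jump (f := fun t => F.rank (-t) y) (x := -y) (y := -x')
    (y' := -x) (by linarith) (by linarith)
    (fun s t hs hst => rank_mono_left hF.finiteDimensional (by linarith) (by linarith))
    fun a ha ha' ε₀ hε₀ => ?_
  · simpa using this
  obtain ⟨ε, hε, hε', hb⟩ := hF.regular (-a)
    (h.mono_left (by linarith) (by linarith : -a ≤ x')).notMem ε₀ hε₀
  refine ⟨ε, hε, hε', fun hx => ?_⟩
  rw [show -(a - ε) = -a + ε by ring, show -(a + ε) = -a - ε by ring,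
    F.rank_eq (show -a + ε ≤ y by linarith), F.rank_eq (show -a - ε ≤ y by linarith),
    ← F.map_comp (show -a - ε ≤ -a + ε by linarith) (show -a + ε ≤ y by linarith),
    LinearMap.range_comp_of_range_eq_top _ (LinearMap.range_eq_top.2 hb.2)]

theorem rank_congr {s s' t t' : ℝ} (hst : s < t) (hst' : s' < t') (hs : SameCell C s s')
    (ht : SameCell C t t') : F.rank s t = F.rank s' t' := by
  rw [hF.rank_eq_of_sameCell_right hst (le_max_left t t') ht.max_left,
    hF.rank_eq_of_sameCell_right hst' (le_max_right t t') ht.max_right]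
  rcases le_total s s' with h | h
  · exact hF.rank_eq_of_sameCell_left (hst'.trans_le (le_max_right _ _)) h hs
  · exact (hF.rank_eq_of_sameCell_left (hst.trans_le (le_max_left _ _)) h hs.symm).symm

omit hF in
/-- The points at which a persistence module has the rank that is generic in their cell. -/
def _root_.MultiPersistence.PersistenceModule.generic (F : PersistenceModule.{v, w} k ℝ)
    (C : Finset ℝ) : Set ℝ :=
  {p | p ∉ C ∧ ∀ q, p < q → SameCell C p q → F.rank p q = Module.finrank k (F.V p)}

theorem exists_generic {x y : ℝ} (hxy : x < y) (hC : ∀ c ∈ C, c ≤ x ∨ y ≤ c) :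
    ∃ p ∈ F.generic C, x < p ∧ p < y := by
  have hcell : ∀ s t, x < s → s < y → x < t → t < y → SameCell C s t := by
    intro s t h1 h2 h3 h4 c hc
    rcases hC c hc with h | h
    · exact Or.inl ⟨by linarith, by linarith⟩
    · exact Or.inr ⟨by linarith, by linarith⟩
  have hm : (x + y) / 2 ∉ C :=
    (hcell _ ((x + y) / 2) (by linarith) (by linarith) (by linarith) (by linarith)).notMem
  obtain ⟨ε, hε, hε', hb⟩ := hF.regular _ hm ((y - x) / 2) (by linarith)
  -- The midpoint is regular, so some map across it, starting at this point, is injective. Its rank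
  -- is the full dimension, and it is also the rank to any later point of the cell.
  refine ⟨(x + y) / 2 - ε, ⟨?_, fun q hq hpq => ?_⟩, by linarith, by linarith⟩
  · exact (hcell _ ((x + y) / 2) (by linarith) (by linarith) (by linarith) (by linarith)).notMem
  · rw [← hF.rank_congr (show (x + y) / 2 - ε < (x + y) / 2 + ε by linarith) hq
      (SameCell.refl hpq.notMem)
      ((hcell _ _ (by linarith) (by linarith) (by linarith) (by linarith)).trans hpq),
      F.rank_eq (by linarith)]
    exact LinearMap.finrank_range_of_inj hb.1

/-- Source and target both have the generic rank of the cell as dimension, and this is also the rank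
of the map. -/
theorem bijective_map {p q : ℝ} (hp : p ∈ F.generic C) (hq : q ∈ F.generic C) (h : p ≤ q)
    (hpq : SameCell C p q) : Function.Bijective (F.map h) := by
  have := hF.finiteDimensional
  rcases h.eq_or_lt with rfl | hlt
  · have : F.map h = LinearMap.id := LinearMap.ext fun v => F.map_refl _ v
    rw [this]
    exact Function.bijective_id
  obtain ⟨δ, hδ, hgap⟩ := exists_gap C q
  have hq' : SameCell C q (q + δ) := fun c hc => by
    rcases hgap c hc with h | h | h
    · exact absurd (h ▸ hc) hq.1
    · exact Or.inl ⟨by linarith, by linarith⟩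
    · exact Or.inr ⟨by linarith, by linarith⟩
  have h1 := hp.2 q hlt hpq
  have h2 := hq.2 (q + δ) (by linarith) hq'
  rw [← hF.rank_congr hlt (by linarith) hpq hq'] at h2
  rw [F.rank_eq h] at h1 h2
  constructor
  · have h3 := LinearMap.finrank_range_add_finrank_ker (F.map h)
    rw [← LinearMap.ker_eq_bot, ← Submodule.finrank_eq_zero (R := k)]
    omega
  · rw [← LinearMap.range_eq_top]
    exact Submodule.eq_top_of_finrank_eq h2

end IsConstructible

/-! ### Barcodes of constructible modules -/

/-- A decomposition of a persistence module over the reals in intervals, up to the behaviour at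
the end points of the intervals and up to elements that do not persist: there are generators and
dual functionals such that every transition map between different real numbers is the sum of its
restrictions to the intervals. -/
structure Barcode (F : PersistenceModule.{v, w} k ℝ) where
  /-- The index type of the bars. -/
  ι : Type
  [fintype : Fintype ι]
  birth : ι → ℝ
  death : ι → WithTop ℝ
  /-- The generator of a bar. -/
  gen : ι → ∀ t, F.V t
  /-- The coordinate along a bar. -/
  coord : ι → ∀ t, F.V t →ₗ[k] k
  birth_lt_death : ∀ I, (birth I : WithTop ℝ) < death I
  map_gen : ∀ I {s t} (h : s ≤ t), birth I < s → F.map h (gen I s) = gen I t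
  coord_map : ∀ I {s t : ℝ} (h : s ≤ t), (t : WithTop ℝ) < death I → ∀ v,
    coord I t (F.map h v) = coord I s v
  gen_eq_zero : ∀ I {t : ℝ}, death I < t → gen I t = 0
  coord_eq_zero : ∀ I {t}, t < birth I → coord I t = 0
  coord_gen_self : ∀ I {t : ℝ}, birth I < t → (t : WithTop ℝ) < death I → coord I t (gen I t) = 1
  coord_gen_of_ne : ∀ {I K}, I ≠ K → ∀ {t : ℝ}, birth I < t → (t : WithTop ℝ) < death K →
    coord K t (gen I t) = 0
  map_eq_sum : ∀ {s t} (h : s < t) v, F.map h.le v = ∑ I, coord I s v • gen I t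

/-- The restriction of a persistence module to a subset of the index set. -/
def restrict (F : PersistenceModule.{v, w} k ℝ) (S : Set ℝ) : PersistenceModule.{v, w} k S where
  V p := F.V p
  map {p q} h := F.map (show p.1 ≤ q.1 from h)
  map_refl p v := F.map_refl p.1 v
  map_map _ _ v := F.map_map _ _ v

/-- A cell is determined by the subset of `C` to its left, and `C` has finitely many subsets. -/
theorem exists_finite_representatives (C : Finset ℝ) (G : Set ℝ) (hG : ∀ p ∈ G, p ∉ C) :
    ∃ S ⊆ G, S.Finite ∧ (∀ q ∈ G, ∃ p ∈ S, SameCell C p q) ∧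
      ∀ p ∈ S, ∀ q ∈ S, SameCell C p q → p = q := by
  set f : ℝ → Finset ℝ := fun p => C.filter (· < p)
  have hf : ∀ p ∈ G, ∀ q ∈ G, SameCell C p q ↔ f p = f q := by
    intro p hp q hq
    constructor
    · intro h
      ext c
      simp only [f, Finset.mem_filter]
      refine and_congr_right fun hc => ?_
      rcases h c hc with h | h
      · simp [h.1, h.2]
      · simp [h.1.not_gt, h.2.not_gt]
    · intro h c hc
      have h1 : c < p ↔ c < q := by
        have := Finset.ext_iff.1 h c
        simpa [f, hc] using this
      rcases lt_trichotomy c p with h2 | rfl | h2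
      · exact Or.inl ⟨h2, h1.1 h2⟩
      · exact absurd hc (hG _ hp)
      · refine Or.inr ⟨h2, lt_of_le_of_ne (not_lt.1 fun h3 => h2.not_gt (h1.2 h3)) ?_⟩
        rintro rfl
        exact hG _ hq hc
  obtain ⟨S, hS, hbij⟩ := Set.exists_subset_bijOn G f
  refine ⟨S, hS, ?_, fun q hq => ?_, fun p hp q hq hpq => ?_⟩
  · refine Set.Finite.of_finite_image (f := f) ?_ hbij.injOn
    refine (Finset.finite_toSet C.powerset).subset ?_
    rintro _ ⟨p, -, rfl⟩
    exact Finset.mem_coe.2 (Finset.mem_powerset.2 (Finset.filter_subset _ _))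
  · obtain ⟨p, hp, hpq⟩ := hbij.surjOn ⟨q, hq, rfl⟩
    exact ⟨p, hp, (hf p (hS hp) q hq).2 hpq⟩
  · exact hbij.injOn hp hq ((hf p (hS hp) q (hS hq)).1 hpq)

namespace IsConstructible

variable {F : PersistenceModule.{v, w} k ℝ} {C : Finset ℝ} (hF : F.IsConstructible C)

include hF

theorem exists_generic_between {x y : ℝ} (hxy : x < y) : ∃ p ∈ F.generic C, x < p ∧ p < y := by
  obtain ⟨δ, hδ, h⟩ := exists_gap C x
  obtain ⟨p, hp, h1, h2⟩ := hF.exists_generic (x := x) (y := min (x + δ) y)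
    (lt_min (by linarith) hxy) fun c hc => by
      rcases h c hc with h | h | h
      · exact Or.inl h.le
      · exact Or.inl (by linarith)
      · exact Or.inr ((min_le_left _ _).trans h.le)
  exact ⟨p, hp, h1, h2.trans_le (min_le_right _ _)⟩

/-- An element at a generic point comes from a compatible family of elements that starts at the
left end of the cell. -/
theorem exists_section {p x : ℝ} (hp : p ∈ F.generic C) (hxp : x < p)
    (hx : ∀ c ∈ C, c ≤ x ∨ p < c) (v : F.V p) :
    ∃ E : ∀ t, F.V t, (∀ {s t} (h : s ≤ t), x < s → F.map h (E s) = E t) ∧ E p = v := by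
  have hcell : ∀ {s t}, x < s → s ≤ p → x < t → t ≤ p → SameCell C s t := by
    intro s t h1 h2 h3 h4 c hc
    rcases hx c hc with h | h
    · exact Or.inl ⟨by linarith, by linarith⟩
    · exact Or.inr ⟨by linarith, by linarith⟩
  have hex : ∀ t, ∃ e : F.V t, x < t → ∃ q ∈ F.generic C, x < q ∧ ∃ (hqp : q ≤ p) (hqt : q ≤ t),
      ∃ z, F.map hqp z = v ∧ F.map hqt z = e := by
    intro t
    by_cases ht : x < t
    -- Pull `v` back to a generic point before both `p` and `t`, where the map to `p` is an
    -- isomorphism, then push forward to `t`. By `huniq`, the values so chosen are compatible.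
    · obtain ⟨q, hq, hxq, hq'⟩ := hF.exists_generic_between (lt_min hxp ht)
      have hqp := (hq'.trans_le (min_le_left _ _)).le
      have hqt := (hq'.trans_le (min_le_right _ _)).le
      obtain ⟨z, hz⟩ := (hF.bijective_map hq hp hqp (hcell hxq hqp hxp le_rfl)).2 v
      exact ⟨F.map hqt z, fun _ => ⟨q, hq, hxq, hqp, hqt, z, hz, rfl⟩⟩
    · exact ⟨0, fun h => absurd h ht⟩
  choose E hE using hex
  have huniq : ∀ {s t} (h : s ≤ t), x < s → F.map h (E s) = E t := by
    intro s t h hs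
    obtain ⟨q, hq, hxq, hqp, hqs, z, hz, hz'⟩ := hE s hs
    obtain ⟨r, hr, hxr, hrp, hrt, y, hy, hy'⟩ := hE t (hs.trans_le h)
    rcases le_total q r with hqr | hrq
    · have : F.map hqr z = y := (hF.bijective_map hr hp hrp (hcell hxr hrp hxp le_rfl)).1 (by
        rw [F.map_map, hz, hy])
      rw [← hz', ← hy', ← this, F.map_map, F.map_map]
    · have : F.map hrq y = z := (hF.bijective_map hq hp hqp (hcell hxq hqp hxp le_rfl)).1 (by
        rw [F.map_map, hz, hy])
      rw [← hz', ← hy', ← this, F.map_map, F.map_map]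
  refine ⟨E, huniq, ?_⟩
  obtain ⟨q, hq, hxq, hqp, hqs, z, hz, hz'⟩ := hE p hxp
  rw [← hz', hz]

/-- A functional at a generic point extends to a compatible family of functionals up to the right
end of the cell. -/
theorem exists_cosection {p : ℝ} {y : WithTop ℝ} (hp : p ∈ F.generic C) (hpy : (p : WithTop ℝ) < y)
    (hy : ∀ c ∈ C, c < p ∨ y ≤ c) (f : F.V p →ₗ[k] k) :
    ∃ L : ∀ t, F.V t →ₗ[k] k, (∀ {s t : ℝ} (h : s ≤ t), (t : WithTop ℝ) < y →
      ∀ v, L t (F.map h v) = L s v) ∧ L p = f := by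
  have hcell : ∀ {t : ℝ}, p ≤ t → (t : WithTop ℝ) < y → SameCell C p t := by
    intro t h3 h4 c hc
    rcases hy c hc with h | h
    · exact Or.inl ⟨h, by linarith⟩
    · exact Or.inr ⟨WithTop.coe_lt_coe.1 (hpy.trans_le h), WithTop.coe_lt_coe.1 (h4.trans_le h)⟩
  have hbtw : ∀ t : ℝ, (t : WithTop ℝ) < y →
      ∃ q ∈ F.generic C, p ≤ q ∧ t ≤ q ∧ (q : WithTop ℝ) < y := by
    intro t ht
    have hm : ((max p t : ℝ) : WithTop ℝ) < y := by
      rcases max_choice p t with h | h <;> rw [h] <;> assumption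
    obtain ⟨z, hz, hz'⟩ : ∃ z : ℝ, max p t < z ∧ (z : WithTop ℝ) ≤ y := by
      induction y with
      | top => exact ⟨max p t + 1, by linarith, le_top⟩
      | coe y => exact ⟨y, WithTop.coe_lt_coe.1 hm, le_rfl⟩
    obtain ⟨q, hq, h1, h2⟩ := hF.exists_generic_between hz
    exact ⟨q, hq, (le_max_left _ _).trans h1.le, (le_max_right _ _).trans h1.le,
      (WithTop.coe_lt_coe.2 h2).trans_le hz'⟩
  have hex : ∀ t : ℝ, ∃ l : F.V t →ₗ[k] k, (t : WithTop ℝ) < y → ∃ q ∈ F.generic C,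
      (q : WithTop ℝ) < y ∧ ∃ (hpq : p ≤ q) (htq : t ≤ q),
      ∃ g : F.V q →ₗ[k] k, (∀ v, g (F.map hpq v) = f v) ∧ ∀ v, g (F.map htq v) = l v := by
    intro t
    by_cases ht : (t : WithTop ℝ) < y
    · obtain ⟨q, hq, hpq, htq, hqy⟩ := hbtw t ht
      set e := LinearEquiv.ofBijective _ (hF.bijective_map hp hq hpq (hcell hpq hqy))
      refine ⟨(f ∘ₗ e.symm.toLinearMap) ∘ₗ F.map htq, fun _ => ⟨q, hq, hqy, hpq, htq,
        f ∘ₗ e.symm.toLinearMap, fun v => ?_, fun _ => rfl⟩⟩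
      exact congrArg f (e.symm_apply_apply v)
    · exact ⟨0, fun h => absurd h ht⟩
  choose L hL using hex
  refine ⟨L, fun {s t} h ht v => ?_, ?_⟩
  · obtain ⟨q, hq, hqy, hpq, htq, g, hg, hg'⟩ := hL t ht
    obtain ⟨r, hr, hry, hpr, hsr, m, hm, hm'⟩ := hL s ((WithTop.coe_le_coe.2 h).trans_lt ht)
    rw [← hg', ← hm', F.map_map]
    rcases le_total q r with hqr | hrq
    · have : ∀ v, m (F.map hqr v) = g v := fun v => by
        obtain ⟨u, rfl⟩ := (hF.bijective_map hp hq hpq (hcell hpq hqy)).2 v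
        rw [F.map_map, hm, hg]
      rw [← this, F.map_map]
    · have : ∀ v, g (F.map hrq v) = m v := fun v => by
        obtain ⟨u, rfl⟩ := (hF.bijective_map hp hr hpr (hcell hpr hry)).2 v
        rw [F.map_map, hm, hg]
      rw [← this, F.map_map]
  · obtain ⟨q, hq, hqy, hpq, htq, g, hg, hg'⟩ := hL p hpy
    ext v
    rw [← hg', hg]

/-- Only the leftmost cell has no left end, and there the module is zero at generic points, since it
vanishes far to the left. -/
theorem exists_left_end {p : ℝ} (hp : p ∈ F.generic C) (hV : Nontrivial (F.V p)) :
    ∃ x ∈ C, x < p ∧ ∀ c ∈ C, c ≤ x ∨ p < c := by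
  by_cases hne : (C.filter (· < p)).Nonempty
  · refine ⟨_, (Finset.mem_filter.1 (Finset.max'_mem _ hne)).1,
      (Finset.mem_filter.1 (Finset.max'_mem _ hne)).2, fun c hc => ?_⟩
    rcases lt_trichotomy c p with h | rfl | h
    · exact Or.inl (Finset.le_max' _ _ (Finset.mem_filter.2 ⟨hc, h⟩))
    · exact absurd hc hp.1
    · exact Or.inr h
  · have hC : ∀ c ∈ C, p < c := fun c hc => by
      rcases lt_trichotomy c p with h | rfl | h
      · exact absurd ⟨c, Finset.mem_filter.2 ⟨hc, h⟩⟩ hne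
      · exact absurd hc hp.1
      · exact h
    obtain ⟨T, hT⟩ := hF.subsingleton
    obtain ⟨q, hq, -, hq'⟩ := hF.exists_generic_between
      (show min T p - 1 < min T p by linarith)
    have h1 := hT q (hq'.trans_le (min_le_left _ _))
    have h2 := hq'.trans_le (min_le_right _ _)
    have h3 := hF.bijective_map hq hp h2.le fun c hc =>
      Or.inr ⟨h2.trans (hC c hc), hC c hc⟩
    exact absurd (h3.2.subsingleton) (not_subsingleton_iff_nontrivial.2 hV)

omit hF in
theorem exists_right_end {p : ℝ} (hp : p ∈ F.generic C) :
    ∃ y : WithTop ℝ, (∀ z : ℝ, y = z → z ∈ C) ∧ (p : WithTop ℝ) < y ∧ ∀ c ∈ C, c < p ∨ y ≤ c := by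
  by_cases hne : (C.filter (p < ·)).Nonempty
  · have hmem := Finset.mem_filter.1 (Finset.min'_mem _ hne)
    refine ⟨((C.filter (p < ·)).min' hne : ℝ), fun z hz => ?_, WithTop.coe_lt_coe.2 hmem.2,
      fun c hc => ?_⟩
    · rw [← WithTop.coe_inj.1 hz]
      exact hmem.1
    · rcases lt_trichotomy c p with h | rfl | h
      · exact Or.inl h
      · exact absurd hc hp.1
      · exact Or.inr (WithTop.coe_le_coe.2 (Finset.min'_le _ _ (Finset.mem_filter.2 ⟨hc, h⟩)))
  · refine ⟨⊤, fun z hz => absurd hz (by simp), WithTop.coe_lt_top p, fun c hc => Or.inl ?_⟩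
    rcases lt_trichotomy c p with h | rfl | h
    · exact h
    · exact absurd hc hp.1
    · exact absurd ⟨c, Finset.mem_filter.2 ⟨hc, h⟩⟩ hne

/-- A constructible persistence module has a barcode. -/
theorem nonempty_barcode : Nonempty (Barcode F) := by
  obtain ⟨S, hSG, hSfin, hSex, hSuniq⟩ :=
    exists_finite_representatives C (F.generic C) fun p hp => hp.1
  have := hSfin.to_subtype
  obtain ⟨D⟩ := (F.restrict S).nonempty_intervalDecomposition fun p => hF.finiteDimensional p.1
  let _ := D.fintype
  have hbS : ∀ I, (D.birth I).1 ∈ F.generic C := fun I => hSG (D.birth I).2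
  have hdS : ∀ I, (D.death I).1 ∈ F.generic C := fun I => hSG (D.death I).2
  have hbd : ∀ I, (D.birth I).1 ≤ (D.death I).1 := fun I => D.birth_le_death I
  have hex : ∀ I, ∃ x ∈ C, x < (D.birth I).1 ∧ ∀ c ∈ C, c ≤ x ∨ (D.birth I).1 < c := fun I => by
    refine hF.exists_left_end (hbS I) ?_
    refine ⟨D.gen I (D.birth I), 0, fun h => ?_⟩
    have := D.coord_gen_self I le_rfl (D.birth_le_death I)
    rw [h] at this
    exact zero_ne_one ((map_zero (D.coord I (D.birth I))).symm.trans this)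
  choose x hxC hxb hx using hex
  choose y hyC hdy hy using fun I => exists_right_end (hdS I)
  -- A bar runs from the left end of the cell of its birth to the right end of the cell of its
  -- death. Its generator and functional extend those of the finite decomposition.
  choose E hE hEb using fun I => hF.exists_section (hbS I) (hxb I) (hx I) (D.gen I (D.birth I))
  choose L hL hLd using fun I => hF.exists_cosection (hdS I) (hdy I) (hy I) (D.coord I (D.death I))
  have hEgen : ∀ I (p : S), D.birth I ≤ p → E I p = D.gen I p := fun I p hp => by
    rw [← hE I (show (D.birth I).1 ≤ p.1 from hp) (hxb I), hEb]
    exact D.map_gen I hp le_rfl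
  have hLcoord : ∀ I (p : S), p ≤ D.death I → L I p = D.coord I p := fun I p hp => by
    ext v
    rw [← hL I (show p.1 ≤ (D.death I).1 from hp) (hdy I), hLd]
    exact D.coord_map I hp le_rfl v
  have hby : ∀ I, ((D.birth I).1 : WithTop ℝ) < y I := fun I =>
    (WithTop.coe_le_coe.2 (hbd I)).trans_lt (hdy I)
  have hxy : ∀ I, (x I : WithTop ℝ) < y I := fun I => (WithTop.coe_lt_coe.2 (hxb I)).trans (hby I)
  have hbirth_le : ∀ I (p : S), x I < p → D.birth I ≤ p := fun I p hp => by
    by_contra! hlt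
    have hlt' : p.1 < (D.birth I).1 := hlt
    refine hlt'.ne (hSuniq _ p.2 _ (D.birth I).2 fun c hc => ?_)
    rcases hx I c hc with h | h
    · exact Or.inl ⟨by linarith, by linarith⟩
    · exact Or.inr ⟨by linarith, by linarith⟩
  have hle_death : ∀ I (p : S), (p.1 : WithTop ℝ) < y I → p ≤ D.death I := fun I p hp => by
    by_contra! hlt
    have hlt' : (D.death I).1 < p.1 := hlt
    refine hlt'.ne (hSuniq _ (D.death I).2 _ p.2 fun c hc => ?_)
    rcases hy I c hc with h | h
    · exact Or.inl ⟨by linarith, by linarith⟩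
    · have := WithTop.coe_lt_coe.1 (hp.trans_le h)
      exact Or.inr ⟨by linarith, by linarith⟩
  -- Factor through a generic point before `x I`. Its cell has a representative in `S`, also before
  -- `x I`, where the coordinate vanishes; the isomorphism between the two transports this.
  have hLzero : ∀ I {s}, s < x I → L I s = 0 := fun I s hs => by
    obtain ⟨q, hq, hsq, hqx⟩ := hF.exists_generic_between hs
    obtain ⟨p, hp, hpq⟩ := hSex q hq
    have hpx : p < x I := by
      rcases hpq _ (hxC I) with h | h <;> linarith [h.1, h.2]
    have hpb : p < (D.birth I).1 := hpx.trans (hxb I)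
    have hLp : L I p = 0 := by
      have h1 := hLcoord I ⟨p, hp⟩ (show p ≤ (D.death I).1 from hpb.le.trans (hbd I))
      exact h1.trans (D.coord_eq_zero I (show (⟨p, hp⟩ : S) < D.birth I from hpb))
    have hqy : (q : WithTop ℝ) < y I := (WithTop.coe_lt_coe.2 hqx).trans (hxy I)
    have hpy : (p : WithTop ℝ) < y I := (WithTop.coe_lt_coe.2 hpx).trans (hxy I)
    ext v
    rw [← hL I hsq.le hqy]
    generalize F.map hsq.le v = v
    rcases le_total p q with h | h
    · obtain ⟨u, rfl⟩ := (hF.bijective_map (hSG hp) hq h hpq).2 v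
      rw [hL I h hqy, hLp]
      simp
    · rw [← hL I h hpy, hLp]
      simp
  have hEzero : ∀ I {t : ℝ}, y I < t → E I t = 0 := fun I t ht => by
    obtain ⟨z, hz⟩ := WithTop.ne_top_iff_exists.1 (ht.trans (WithTop.coe_lt_top t)).ne
    have hzC := hyC I z hz.symm
    rw [← hz] at ht
    have hdz : (D.death I).1 < z := WithTop.coe_lt_coe.1 (hz ▸ hdy I)
    obtain ⟨q, hq, hzq, hqt⟩ := hF.exists_generic_between (WithTop.coe_lt_coe.1 ht)
    obtain ⟨p, hp, hpq⟩ := hSex q hq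
    have hzp : z < p := by
      rcases hpq _ hzC with h | h <;> linarith [h.1, h.2]
    have hdp : (D.death I).1 < p := hdz.trans hzp
    have hxp : x I < p := (hxb I).trans ((hbd I).trans_lt hdp)
    have hxq : x I < q := (hxb I).trans ((hbd I).trans_lt (hdz.trans hzq))
    have hEp : E I p = 0 := by
      have h1 := hEgen I ⟨p, hp⟩ (show (D.birth I).1 ≤ p from (hbd I).trans hdp.le)
      exact h1.trans (D.gen_eq_zero I (show D.death I < (⟨p, hp⟩ : S) from hdp))
    have hEq : E I q = 0 := by
      rcases le_total p q with h | h
      · rw [← hE I h hxp, hEp, map_zero]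
      · apply (hF.bijective_map hq (hSG hp) h hpq.symm).1
        rw [hE I h hxq, hEp, map_zero]
    rw [← hE I hqt.le hxq, hEq, map_zero]
  have hpair : ∀ I K {s t : ℝ} (_ : s ≤ t), x I < s → (t : WithTop ℝ) < y K →
      L K s (E I s) = L K t (E I t) := fun I K s t h hs ht => by
    rw [← hE I h hs, hL K h ht]
  -- the summand of a bar is compatible with transition maps that start or end at a regular value
  have hterm : ∀ I {q s t : ℝ}, q ∉ C → ∀ (hsq : s ≤ q) (hqt : q ≤ t) (v : F.V s),
      L I q (F.map hsq v) • F.map hqt (E I q) = L I s v • E I t := by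
    intro I q s t hq hsq hqt v
    rcases lt_trichotomy q (x I) with h | h | h
    · rw [hLzero I h, hLzero I (hsq.trans_lt h)]
      simp
    · exact absurd (h ▸ hxC I) hq
    rw [hE I hqt h]
    rcases lt_trichotomy (q : WithTop ℝ) (y I) with h' | h' | h'
    · rw [hL I hsq h']
    · exact absurd (hyC I q h'.symm) hq
    · rw [hEzero I (h'.trans_le (WithTop.coe_le_coe.2 hqt)), smul_zero, smul_zero]
  have hsumS : ∀ p (hp : p ∈ S) v, ∑ I, L I p v • E I p = v := fun p hp v => by
    refine (Finset.sum_congr rfl fun I _ => ?_).trans (D.sum_coord ⟨p, hp⟩ v)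
    rcases lt_or_ge (⟨p, hp⟩ : S) (D.birth I) with h | h
    · have h1 := hLcoord I ⟨p, hp⟩ (h.le.trans (D.birth_le_death I))
      rw [D.coord_eq_zero I h] at h1 ⊢
      rw [show L I p = 0 from h1]
      exact (zero_smul k _).trans (zero_smul k _).symm
    rcases lt_or_ge (D.death I) (⟨p, hp⟩ : S) with h' | h'
    · have h1 := hEgen I ⟨p, hp⟩ h
      rw [D.gen_eq_zero I h'] at h1 ⊢
      rw [show E I p = 0 from h1]
      exact (smul_zero _).trans (smul_zero _).symm
    · exact congr_arg₂ (· • ·) (DFunLike.congr_fun (hLcoord I ⟨p, hp⟩ h') v) (hEgen I ⟨p, hp⟩ h)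
  -- The expansion in generators holds at the representatives and is carried to all generic points
  -- by the isomorphisms within a cell.
  have hsum : ∀ q ∈ F.generic C, ∀ v, ∑ I, L I q v • E I q = v := fun q hq v => by
    obtain ⟨p, hp, hpq⟩ := hSex q hq
    rcases le_total p q with h | h
    · obtain ⟨u, rfl⟩ := (hF.bijective_map (hSG hp) hq h hpq).2 v
      conv_rhs => rw [← hsumS p hp u, map_sum]
      refine Finset.sum_congr rfl fun I _ => ?_
      rw [map_smul]
      have h1 := hterm I hq.1 h le_rfl u
      have h2 := hterm I (hSG hp).1 le_rfl h u
      rw [F.map_refl] at h1 h2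
      rw [h1, h2]
    · apply (hF.bijective_map hq (hSG hp) h hpq.symm).1
      conv_rhs => rw [← hsumS p hp (F.map h v)]
      rw [map_sum]
      refine Finset.sum_congr rfl fun I _ => ?_
      rw [map_smul]
      have h1 := hterm I (hSG hp).1 h le_rfl v
      have h2 := hterm I hq.1 le_rfl h v
      rw [F.map_refl] at h1 h2
      rw [h1, h2]
  refine ⟨{ ι := D.ι, birth := x, death := y, gen := E, coord := L, birth_lt_death := hxy
            map_gen := fun I {s t} h hs => hE I h hs
            coord_map := fun I {s t} h ht => hL I h ht
            gen_eq_zero := hEzero, coord_eq_zero := hLzero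
            coord_gen_self := ?_, coord_gen_of_ne := ?_, map_eq_sum := ?_ }⟩
  · intro I t ht ht'
    have h1 : L I (D.birth I) (E I (D.birth I)) = 1 := by
      rw [hEgen I _ le_rfl, hLcoord I _ (D.birth_le_death I)]
      exact D.coord_gen_self I le_rfl (D.birth_le_death I)
    rcases le_total t (D.birth I).1 with h | h
    · rw [hpair I I h ht (hby I), h1]
    · rw [← hpair I I h (hxb I) ht', h1]
  · intro I K hne t ht ht'
    obtain ⟨q, hq, hxq, hqt⟩ := hF.exists_generic_between ht
    obtain ⟨p, hp, hpq⟩ := hSex q hq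
    have hqy := (WithTop.coe_lt_coe.2 hqt).trans ht'
    have hxp : x I < p := by
      rcases hpq _ (hxC I) with h | h <;> linarith [h.1, h.2]
    have hpy : (p : WithTop ℝ) < y K := by
      rcases lt_trichotomy (p : WithTop ℝ) (y K) with h | h | h
      · exact h
      · exact absurd (hyC K p h.symm) (hSG hp).1
      · obtain ⟨z, hz⟩ := WithTop.ne_top_iff_exists.1 (h.trans (WithTop.coe_lt_top p)).ne
        have hzC := hyC K z hz.symm
        rw [← hz] at h hqy
        have h1 := WithTop.coe_lt_coe.1 h
        have h2 := WithTop.coe_lt_coe.1 hqy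
        rcases hpq _ hzC with h | h <;> linarith [h.1, h.2]
    have h1 : L K p (E I p) = 0 := by
      have h2 := hbirth_le I ⟨p, hp⟩ hxp
      have h3 := hle_death K ⟨p, hp⟩ hpy
      have h4 := hEgen I ⟨p, hp⟩ h2
      have h5 := hLcoord K ⟨p, hp⟩ h3
      rw [show E I p = _ from h4, show L K p = _ from h5]
      exact D.coord_gen_of_ne hne h2 h3
    rw [← hpair I K hqt.le hxq ht']
    rcases le_total p q with h | h
    · rw [← hpair I K h hxp hqy, h1]
    · rw [hpair I K h hxq hpy, h1]
  · intro s t h v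
    -- Expanding at an intermediate generic point is what requires `s < t`.
    obtain ⟨q, hq, hsq, hqt⟩ := hF.exists_generic_between h
    rw [← F.map_map hsq.le hqt.le, ← hsum q hq (F.map hsq.le v), map_sum]
    exact Finset.sum_congr rfl fun I _ => by
      rw [map_smul, hterm I hq.1 hsq.le hqt.le v]

end IsConstructible

/-! ### Multiplicities of the rank invariant count bars -/

namespace Barcode

variable {F : PersistenceModule.{v, w} k ℝ} (B : Barcode F)

attribute [instance] Barcode.fintype

/-- The point of the extended plane given by a bar. -/
def point (I : B.ι) : ExtPoint := (B.birth I, B.death I)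

/-- The finite end points of the bars. -/
def ends : Finset ℝ :=
  Finset.univ.image B.birth ∪ Finset.univ.image fun I => (B.death I).untopD 0

theorem birth_mem_ends (I : B.ι) : B.birth I ∈ B.ends :=
  Finset.mem_union_left _ (Finset.mem_image_of_mem _ (Finset.mem_univ I))

theorem mem_ends_of_death_eq {I : B.ι} {y : ℝ} (h : B.death I = y) : y ∈ B.ends :=
  Finset.mem_union_right _ (Finset.mem_image.2 ⟨I, Finset.mem_univ I, by rw [h]; rfl⟩)

open Classical in
/-- Away from the end points of the bars, the rank of a transition map is the number of bars that
contain the two indices. -/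
theorem rank_eq_card {s t : ℝ} (h : s < t) (hs : s ∉ B.ends) (ht : t ∉ B.ends) :
    F.rank s t = Fintype.card {I // B.birth I < s ∧ (t : WithTop ℝ) < B.death I} := by
  rw [F.rank_eq h.le]
  have hli : LinearIndependent k
      fun I : {I // B.birth I < s ∧ (t : WithTop ℝ) < B.death I} => B.gen I.1 t := by
    rw [Fintype.linearIndependent_iff]
    intro g hg K
    have h1 := congrArg (B.coord K.1 t) hg
    rw [map_sum, map_zero, Finset.sum_eq_single K] at h1
    · rwa [map_smul, B.coord_gen_self K.1 (K.2.1.trans h) K.2.2, smul_eq_mul, mul_one] at h1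
    · intro I _ hne
      rw [map_smul, B.coord_gen_of_ne (fun e => hne (Subtype.ext e)) (I.2.1.trans h) K.2.2,
        smul_zero]
    · intro h
      exact absurd (Finset.mem_univ K) h
  rw [← finrank_span_eq_card hli]
  suffices h : LinearMap.range (F.map h.le) = Submodule.span k (Set.range
      fun I : {I // B.birth I < s ∧ (t : WithTop ℝ) < B.death I} => B.gen I.1 t) by rw [h]
  apply le_antisymm
  · rintro _ ⟨v, rfl⟩
    rw [B.map_eq_sum h]
    refine Submodule.sum_mem _ fun I _ => ?_
    rcases lt_trichotomy s (B.birth I) with h1 | h1 | h1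
    · simp [B.coord_eq_zero I h1]
    · exact absurd (h1 ▸ B.birth_mem_ends I) hs
    rcases lt_trichotomy (t : WithTop ℝ) (B.death I) with h2 | h2 | h2
    · exact Submodule.smul_mem _ _ (Submodule.subset_span ⟨⟨I, h1, h2⟩, rfl⟩)
    · exact absurd (B.mem_ends_of_death_eq h2.symm) ht
    · simp [B.gen_eq_zero I h2]
  · rw [Submodule.span_le]
    rintro _ ⟨I, rfl⟩
    exact ⟨B.gen I.1 s, B.map_gen I.1 h.le I.2.1⟩

theorem death_cases {δ y : ℝ} (hgap : ∀ c ∈ B.ends, c = y ∨ c < y - δ ∨ y + δ < c) (I : B.ι) :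
    B.death I = y ∨ B.death I < ((y - δ : ℝ) : WithTop ℝ) ∨
      ((y + δ : ℝ) : WithTop ℝ) < B.death I := by
  have := @mem_ends_of_death_eq _ _ _ B I
  generalize B.death I = d at this ⊢
  induction d with
  | top => exact Or.inr (Or.inr (WithTop.coe_lt_top _))
  | coe d =>
    rcases hgap d (this rfl) with h | h | h
    · exact Or.inl (by rw [h])
    · exact Or.inr (Or.inl (WithTop.coe_lt_coe.2 h))
    · exact Or.inr (Or.inr (WithTop.coe_lt_coe.2 h))

theorem add_notMem_ends {δ y : ℝ} (hδ : 0 < δ)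
    (hgap : ∀ c ∈ B.ends, c = y ∨ c < y - δ ∨ y + δ < c) : y + δ ∉ B.ends := fun h => by
  rcases hgap _ h with h | h | h <;> linarith

theorem sub_notMem_ends {δ y : ℝ} (hδ : 0 < δ)
    (hgap : ∀ c ∈ B.ends, c = y ∨ c < y - δ ∨ y + δ < c) : y - δ ∉ B.ends := fun h => by
  rcases hgap _ h with h | h | h <;> linarith

open Classical in
/-- The alternating sum of ranks in a small box counts the bars at its centre. -/
theorem card_eq_alternating {x y ε : ℝ} (hε : 0 < ε) (h : x + ε < y - ε)
    (hx : ∀ c ∈ B.ends, c = x ∨ c < x - ε ∨ x + ε < c)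
    (hy : ∀ c ∈ B.ends, c = y ∨ c < y - ε ∨ y + ε < c) :
    (Fintype.card {I // B.point I = (x, (y : WithTop ℝ))} : ℤ) =
      F.rank (x + ε) (y - ε) - F.rank (x - ε) (y - ε) - F.rank (x + ε) (y + ε)
        + F.rank (x - ε) (y + ε) := by
  have hx1 := B.add_notMem_ends hε hx
  have hx2 := B.sub_notMem_ends hε hx
  have hy1 := B.add_notMem_ends hε hy
  have hy2 := B.sub_notMem_ends hε hy
  rw [B.rank_eq_card h hx1 hy2, B.rank_eq_card (by linarith) hx2 hy2,
    B.rank_eq_card (by linarith) hx1 hy1, B.rank_eq_card (by linarith) hx2 hy1]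
  simp only [Fintype.card_subtype, Finset.card_filter, Nat.cast_sum, ← Finset.sum_sub_distrib,
    ← Finset.sum_add_distrib]
  refine Finset.sum_congr rfl fun I _ => ?_
  have h1 : ((y - ε : ℝ) : WithTop ℝ) < (y : ℝ) := WithTop.coe_lt_coe.2 (by linarith)
  have h2 : ((y : ℝ) : WithTop ℝ) < (y + ε : ℝ) := WithTop.coe_lt_coe.2 (by linarith)
  have h3 : B.point I = (x, (y : WithTop ℝ)) ↔ B.birth I = x ∧ B.death I = y := Prod.ext_iff
  have a1 : B.birth I < x + ε ↔ B.birth I = x ∨ B.birth I < x - ε := by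
    constructor
    · intro h
      rcases hx _ (B.birth_mem_ends I) with h' | h' | h'
      exacts [Or.inl h', Or.inr h', absurd h h'.not_gt]
    · rintro (h | h) <;> linarith
  have a2 : ((y - ε : ℝ) : WithTop ℝ) < B.death I ↔
      B.death I = y ∨ ((y + ε : ℝ) : WithTop ℝ) < B.death I := by
    constructor
    · intro h
      rcases B.death_cases hy I with h' | h' | h'
      exacts [Or.inl h', absurd h h'.not_gt, Or.inr h']
    · rintro (h | h)
      · rwa [h]
      · exact h1.trans (h2.trans h)
  have a3 : B.birth I < x - ε → B.birth I ≠ x := fun h h' => by linarith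
  have a4 : ((y + ε : ℝ) : WithTop ℝ) < B.death I → B.death I ≠ y := fun h h' => by
    rw [h'] at h
    exact h.not_gt h2
  simp only [h3, a1, a2]
  by_cases c1 : B.birth I < x - ε <;> by_cases c2 : ((y + ε : ℝ) : WithTop ℝ) < B.death I
  · simp [c2, a3 c1, -WithTop.coe_add]
  · simp [c2, a3 c1, -WithTop.coe_add]
  · simp [c1, c2, a4 c2, -WithTop.coe_add]
  · simp [c1, c2, -WithTop.coe_add]

open Classical in
theorem card_eq_sub {x t ε : ℝ} (hε : 0 < ε) (h : x + ε < t)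
    (hx : ∀ c ∈ B.ends, c = x ∨ c < x - ε ∨ x + ε < c) (ht : ∀ c ∈ B.ends, c < t) :
    (Fintype.card {I // B.point I = (x, (⊤ : WithTop ℝ))} : ℤ) =
      F.rank (x + ε) t - F.rank (x - ε) t := by
  have ht' : t ∉ B.ends := fun h => lt_irrefl _ (ht _ h)
  rw [B.rank_eq_card h (B.add_notMem_ends hε hx) ht',
    B.rank_eq_card (by linarith) (B.sub_notMem_ends hε hx) ht']
  simp only [Fintype.card_subtype, Finset.card_filter, Nat.cast_sum, ← Finset.sum_sub_distrib]
  refine Finset.sum_congr rfl fun I _ => ?_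
  have h3 : B.point I = (x, (⊤ : WithTop ℝ)) ↔ B.birth I = x ∧ B.death I = ⊤ := Prod.ext_iff
  have a1 : B.birth I < x + ε ↔ B.birth I = x ∨ B.birth I < x - ε := by
    constructor
    · intro h
      rcases hx _ (B.birth_mem_ends I) with h' | h' | h'
      exacts [Or.inl h', Or.inr h', absurd h h'.not_gt]
    · rintro (h | h) <;> linarith
  have a2 : (t : WithTop ℝ) < B.death I ↔ B.death I = ⊤ := by
    constructor
    · intro h
      by_contra hne
      obtain ⟨z, hz⟩ := WithTop.ne_top_iff_exists.1 hne
      rw [← hz] at h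
      exact (ht z (B.mem_ends_of_death_eq hz.symm)).not_gt (WithTop.coe_lt_coe.1 h)
    · intro h
      rw [h]
      exact WithTop.coe_lt_top t
  have a3 : B.birth I < x - ε → B.birth I ≠ x := fun h h' => by linarith
  simp only [h3, a1, a2]
  by_cases c1 : B.birth I < x - ε
  · simp [c1, a3 c1]
  · simp [c1]

theorem exists_small {x ε₀ : ℝ} (hε₀ : 0 < ε₀) :
    ∃ δ, 0 < δ ∧ δ ≤ ε₀ ∧ ∀ ε ≤ δ, ∀ c ∈ B.ends, c = x ∨ c < x - ε ∨ x + ε < c := by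
  obtain ⟨δ, hδ, h⟩ := exists_gap B.ends x
  refine ⟨min δ ε₀, lt_min hδ hε₀, min_le_right _ _, fun ε hε c hc => ?_⟩
  have := hε.trans (min_le_left _ _)
  rcases h c hc with h | h | h
  · exact Or.inl h
  · exact Or.inr (Or.inl (by linarith))
  · exact Or.inr (Or.inr (by linarith))

section Multiplicity

variable (hF : ∀ t, FiniteDimensional k (F.V t)) {ρ : DeltaPlus → ℕ}
  (hρ : ∀ s t (h : s < t), ρ ⟨(s, t), h⟩ = F.rank s t)

include hF hρ

-- For small `ε` the alternating sum is the number of bars at `(x, y)`, and shrinking `ε` never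
-- increases it; so this number is the minimum. For `y ≤ x` both sides are 0, the left one because
-- the infimum of the empty set is 0.
open Classical in
theorem properMultiplicity_eq (x y : ℝ) :
    properMultiplicity ρ x y = Fintype.card {I // B.point I = (x, (y : WithTop ℝ))} := by
  unfold properMultiplicity
  simp only [hρ]
  rcases le_or_gt y x with hyx | hxy
  · have h0 : Fintype.card {I // B.point I = (x, (y : WithTop ℝ))} = 0 := by
      rw [Fintype.card_eq_zero_iff]
      refine ⟨fun I => ?_⟩
      have h1 := B.birth_lt_death I.1
      have h2 : B.birth I.1 = x := (Prod.ext_iff.1 I.2).1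
      have h3 : B.death I.1 = y := (Prod.ext_iff.1 I.2).2
      rw [h2, h3] at h1
      exact hyx.not_gt (WithTop.coe_lt_coe.1 h1)
    rw [h0]
    convert Nat.sInf_empty
    rw [Set.eq_empty_iff_forall_notMem]
    rintro m ⟨ε, hε, h, -⟩
    linarith
  have key : ∀ ε₀ > 0, ∃ ε, 0 < ε ∧ ε ≤ ε₀ ∧ x + ε < y - ε ∧
      (Fintype.card {I // B.point I = (x, (y : WithTop ℝ))} : ℤ) =
      F.rank (x + ε) (y - ε) - F.rank (x - ε) (y - ε) - F.rank (x + ε) (y + ε)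
        + F.rank (x - ε) (y + ε) := by
    intro ε₀ hε₀
    obtain ⟨δ, hδ, hδ', h⟩ := B.exists_small (x := x) hε₀
    obtain ⟨δ', hδ₁, hδ₂, h'⟩ := B.exists_small (x := y) (lt_min hδ (show 0 < (y - x) / 3 by
      linarith))
    have h1 := hδ₂.trans (min_le_left _ _)
    have h2 := hδ₂.trans (min_le_right _ _)
    have h3 : x + δ' < y - δ' := by linarith
    exact ⟨δ', hδ₁, by linarith, h3, B.card_eq_alternating hδ₁ h3 (h _ h1) (h' _ le_rfl)⟩
  refine le_antisymm (Nat.sInf_le ?_) ?_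
  · obtain ⟨ε, hε, -, h, hcard⟩ := key 1 one_pos
    exact ⟨ε, hε, h, hcard⟩
  · refine le_csInf ?_ ?_
    · obtain ⟨ε, hε, -, h, hcard⟩ := key 1 one_pos
      exact ⟨_, ε, hε, h, hcard⟩
    · rintro m ⟨ε, hε, h, hm⟩
      obtain ⟨ε', hε', hle, h', hcard⟩ := key ε hε
      -- The box of size `ε` minus that of size `ε'` consists of four rectangles: left, right, and
      -- the two between them. The alternating sum over each is nonnegative by Frobenius'
      -- inequality.
      have e1 := rank_add_rank_le hF (show x - ε ≤ x - ε' by linarith)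
        (show x - ε' ≤ y - ε by linarith) (show y - ε ≤ y + ε by linarith)
      have e2 := rank_add_rank_le hF (show x + ε' ≤ x + ε by linarith) h.le
        (show y - ε ≤ y + ε by linarith)
      have e3 := rank_add_rank_le hF (show x - ε' ≤ x + ε' by linarith)
        (show x + ε' ≤ y - ε by linarith) (show y - ε ≤ y - ε' by linarith)
      have e4 := rank_add_rank_le hF (show x - ε' ≤ x + ε' by linarith)
        (show x + ε' ≤ y + ε' by linarith) (show y + ε' ≤ y + ε by linarith)
      omega

open Classical in
theorem infiniteMultiplicity_eq (x : ℝ) :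
    infiniteMultiplicity ρ x = Fintype.card {I // B.point I = (x, (⊤ : WithTop ℝ))} := by
  unfold infiniteMultiplicity
  simp only [hρ]
  have key : ∀ ε₀ > 0, ∀ t₀, ∃ ε t, 0 < ε ∧ ε ≤ ε₀ ∧ x + ε < t ∧ t₀ ≤ t ∧
      (Fintype.card {I // B.point I = (x, (⊤ : WithTop ℝ))} : ℤ) =
      F.rank (x + ε) t - F.rank (x - ε) t := by
    intro ε₀ hε₀ t₀
    obtain ⟨δ, hδ, hδ', h⟩ := B.exists_small (x := x) hε₀
    obtain ⟨M, hM⟩ := B.ends.bddAbove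
    have h1 : x + δ < max (max (M + 1) t₀) (x + δ + 1) := lt_max_of_lt_right (by linarith)
    refine ⟨δ, max (max (M + 1) t₀) (x + δ + 1), hδ, hδ', h1,
      le_max_of_le_left (le_max_right _ _), B.card_eq_sub hδ h1 (h _ le_rfl) fun c hc => ?_⟩
    have := hM hc
    exact lt_max_of_lt_left (lt_max_of_lt_left (by linarith))
  refine le_antisymm (Nat.sInf_le ?_) ?_
  · obtain ⟨ε, t, hε, -, h, -, hcard⟩ := key 1 one_pos 0
    exact ⟨ε, t, hε, h, hcard⟩
  · refine le_csInf ?_ ?_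
    · obtain ⟨ε, t, hε, -, h, -, hcard⟩ := key 1 one_pos 0
      exact ⟨_, ε, t, hε, h, hcard⟩
    · rintro m ⟨ε, t, hε, h, hm⟩
      obtain ⟨ε', t', hε', hle, h', hle', hcard⟩ := key ε hε t
      -- The difference of ranks decreases when `t` grows, by Frobenius, and when `ε` shrinks, by
      -- monotonicity.
      have e1 := rank_add_rank_le hF (show x - ε ≤ x + ε by linarith) h.le hle'
      have e2 := rank_mono_left hF (show x + ε' ≤ x + ε by linarith) (show x + ε ≤ t' by linarith)
      have e3 := rank_mono_left hF (show x - ε ≤ x - ε' by linarith) (show x - ε' ≤ t' by linarith)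
      omega

open Classical in
theorem multiplicity_eq (p : ExtPoint) :
    multiplicity ρ p = Fintype.card {I // B.point I = p} := by
  match p with
  | (x, ⊤) => exact B.infiniteMultiplicity_eq hF hρ x
  | (x, WithTop.some y) => exact B.properMultiplicity_eq hF hρ x y

/-- The persistence diagram consists of the bars and of the points of the diagonal. -/
theorem exists_diagram_equiv : ∃ e : Diagram ρ ≃ B.ι ⊕ ℚ, ∀ P, P.point =
    Sum.elim B.point (fun q : ℚ => (((q : ℝ), ((q : ℝ) : WithTop ℝ)) : ExtPoint)) (e P) := by
  classical
  let e₁ : (Σ p : ExtPoint, Fin (multiplicity ρ p)) ≃ Σ p : ExtPoint, {I // B.point I = p} :=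
    Equiv.sigmaCongrRight fun p =>
      (finCongr (B.multiplicity_eq hF hρ p)).trans (Fintype.equivFin _).symm
  refine ⟨(e₁.trans (Equiv.sigmaFiberEquiv B.point)).sumCongr (Equiv.refl ℚ), ?_⟩
  rintro (c | q)
  · exact (e₁ c).2.2.symm
  · rfl

end Multiplicity

end Barcode

end PersistenceModule

/-! ### Interleavings and matchings of barcodes -/

theorem pointDist_comm (p q : ExtPoint) : pointDist p q = pointDist q p := by
  have h : ∀ a b, extAbsSub a b = extAbsSub b a := by
    intro a b
    match a, b with
    | ⊤, ⊤ => rfl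
    | ⊤, WithTop.some _ => rfl
    | WithTop.some _, ⊤ => rfl
    | WithTop.some a, WithTop.some b =>
      exact congrArg ENNReal.ofReal (abs_sub_comm a b)
  unfold pointDist
  rw [abs_sub_comm, h, max_comm (halfPersistence p)]

theorem pointDist_diagonal_le {p : ExtPoint} {r : ENNReal} (h : halfPersistence p ≤ r) (x : ℝ) :
    pointDist p (x, (x : WithTop ℝ)) ≤ r := by
  refine (min_le_right _ _).trans (max_le h ?_)
  change ENNReal.ofReal ((x - x) / 2) ≤ r
  simp

namespace PersistenceModule

variable {k : Type v} [Field k]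

/-- An `η`-interleaving of two persistence modules. -/
structure Interleaving (F G : PersistenceModule.{v, w} k ℝ) (η : ℝ) where
  hom : ∀ {s t}, s + η ≤ t → F.V s →ₗ[k] G.V t
  inv : ∀ {s t}, s + η ≤ t → G.V s →ₗ[k] F.V t
  map_hom : ∀ {r s t} (h : r + η ≤ s) (h' : s ≤ t) v, G.map h' (hom h v) = hom (h.trans h') v
  hom_map : ∀ {r s t} (h : r ≤ s) (h' : s + η ≤ t) (h'' : r + η ≤ t) v,
    hom h' (F.map h v) = hom h'' v
  map_inv : ∀ {r s t} (h : r + η ≤ s) (h' : s ≤ t) v, F.map h' (inv h v) = inv (h.trans h') v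
  inv_map : ∀ {r s t} (h : r ≤ s) (h' : s + η ≤ t) (h'' : r + η ≤ t) v,
    inv h' (G.map h v) = inv h'' v
  inv_hom : ∀ {r s t} (h : r + η ≤ s) (h' : s + η ≤ t) (h'' : r ≤ t) v,
    inv h' (hom h v) = F.map h'' v
  hom_inv : ∀ {r s t} (h : r + η ≤ s) (h' : s + η ≤ t) (h'' : r ≤ t) v,
    hom h' (inv h v) = G.map h'' v

/-- Interleavings are symmetric. -/
def Interleaving.symm {F G : PersistenceModule.{v, w} k ℝ} {η : ℝ} (Φ : Interleaving F G η) :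
    Interleaving G F η where
  hom := Φ.inv
  inv := Φ.hom
  map_hom := Φ.map_inv
  hom_map := Φ.inv_map
  map_inv := Φ.map_hom
  inv_map := Φ.hom_map
  inv_hom := Φ.hom_inv
  hom_inv := Φ.inv_hom

namespace Barcode

variable {F G : PersistenceModule.{v, w} k ℝ} (B : Barcode F) (B' : Barcode G)

/-- The death of a bar, or `T` if the bar is infinite. -/
def cappedDeath (T : ℝ) (I : B.ι) : ℝ := (B.death I).untopD T

theorem coe_lt_death {T t : ℝ} {I : B.ι} (h : t < B.cappedDeath T I) :
    (t : WithTop ℝ) < B.death I := by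
  unfold cappedDeath at h
  generalize B.death I = d at h ⊢
  induction d with
  | top => exact WithTop.coe_lt_top t
  | coe d => exact WithTop.coe_lt_coe.2 h

theorem gen_eq_zero_of_cappedDeath_lt {T t : ℝ} {I : B.ι} (h : B.cappedDeath T I < t)
    (ht : t < T) : B.gen I t = 0 := by
  refine B.gen_eq_zero I ?_
  unfold cappedDeath at h
  generalize B.death I = d at h ⊢
  induction d with
  | top => exact absurd h ht.not_gt
  | coe d => exact WithTop.coe_lt_coe.2 h

section Interleaving

variable {η T : ℝ} (Φ : Interleaving F G η)

/-- The coefficient of the morphism of an interleaving between two bars. -/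
def homCoeff (θ : ℝ) (I : B.ι) (J : B'.ι) : k :=
  -- The generator is evaluated at `θ - η` after its birth, since it is controlled only strictly
  -- after it; this is why `θ` is later taken larger than `η`.
  B'.coord J (B.birth I + θ)
    (Φ.hom (show B.birth I + (θ - η) + η ≤ B.birth I + θ by linarith)
      (B.gen I (B.birth I + (θ - η))))

/-- The coefficient of the inverse morphism of an interleaving between two bars. -/
def invCoeff (T θ : ℝ) (J : B'.ι) (K : B.ι) : k :=
  B.coord K (B.cappedDeath T K - (θ - η))
    (Φ.inv (show B.cappedDeath T K - θ + η ≤ B.cappedDeath T K - (θ - η) by linarith)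
      (B'.gen J (B.cappedDeath T K - θ)))

variable {B B'} {θ : ℝ}

/-- The coordinate of `J` is zero before the birth of `J`. If `J` outlived `I` by more than `θ`, the
coefficient could be computed after the death of `I`, from a generator that is already zero. -/
theorem of_homCoeff_ne_zero (hη : 0 ≤ η) (hηθ : η < θ) (hT' : ∀ J, B'.cappedDeath T J ≤ T) {I : B.ι} {J : B'.ι}
    (hI : B.birth I < B.cappedDeath T I) (h : B.homCoeff B' Φ θ I J ≠ 0) :
    B'.birth J ≤ B.birth I + θ ∧ B'.cappedDeath T J ≤ B.cappedDeath T I + θ := by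
  constructor <;> by_contra! hlt
  · exact h (by rw [homCoeff, B'.coord_eq_zero J hlt, LinearMap.zero_apply])
  · apply h
    have hT := hT' J
    rw [homCoeff, ← B'.coord_map J (show B.birth I + θ ≤ B.cappedDeath T I + θ by linarith)
      (B'.coe_lt_death hlt), Φ.map_hom,
      ← Φ.hom_map (show B.birth I + (θ - η) ≤ B.cappedDeath T I + (θ - η) by linarith)
        (show B.cappedDeath T I + (θ - η) + η ≤ B.cappedDeath T I + θ by linarith),
      B.map_gen I _ (by linarith),
      B.gen_eq_zero_of_cappedDeath_lt (T := T) (by linarith) (by linarith), map_zero, map_zero]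

theorem of_invCoeff_ne_zero (hη : 0 ≤ η) (hηθ : η < θ) (hT : ∀ I, B.cappedDeath T I ≤ T) {J : B'.ι} {K : B.ι}
    (hK : B.birth K < B.cappedDeath T K) (h : B.invCoeff B' Φ T θ J K ≠ 0) :
    B.birth K ≤ B'.birth J + θ ∧ B.cappedDeath T K ≤ B'.cappedDeath T J + θ := by
  constructor <;> by_contra! hlt
  · apply h
    rw [invCoeff, ← B'.map_gen J
        (show B.birth K - θ ≤ B.cappedDeath T K - θ by linarith) (by linarith),
      Φ.inv_map _ _ (show B.birth K - θ + η ≤ B.cappedDeath T K - (θ - η) by linarith),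
      ← Φ.map_inv (show B.birth K - θ + η ≤ B.birth K - (θ - η) by linarith)
        (show B.birth K - (θ - η) ≤ B.cappedDeath T K - (θ - η) by linarith),
      B.coord_map K _ (B.coe_lt_death (T := T) (by linarith)),
      B.coord_eq_zero K (by linarith), LinearMap.zero_apply]
  · have := hT K
    exact h (by rw [invCoeff, B'.gen_eq_zero_of_cappedDeath_lt (T := T) (by linarith) (by linarith),
      map_zero, map_zero])

-- Expanding a transition map of `G` in its bars turns the matrix product into a coefficient of
-- inverse after morphism, that is, of a transition map of `F`.
open Classical in
theorem sum_invCoeff_mul_homCoeff (hη : 0 ≤ η) (hηθ : η < θ) {I K : B.ι}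
    (hIK : B.birth I + 2 * θ < B.cappedDeath T K) :
    ∑ J, B.invCoeff B' Φ T θ J K * B.homCoeff B' Φ θ I J = if I = K then 1 else 0 := by
  have h1 : ∀ J, B.invCoeff B' Φ T θ J K * B.homCoeff B' Φ θ I J =
      (B.coord K (B.cappedDeath T K - (θ - η)) ∘ₗ
        Φ.inv (show B.cappedDeath T K - θ + η ≤ B.cappedDeath T K - (θ - η) by linarith))
      (B.homCoeff B' Φ θ I J • B'.gen J (B.cappedDeath T K - θ)) := fun J => by
    rw [map_smul, smul_eq_mul, mul_comm]
    rfl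
  rw [Finset.sum_congr rfl fun J _ => h1 J, ← map_sum]
  simp only [homCoeff]
  rw [← B'.map_eq_sum (show B.birth I + θ < B.cappedDeath T K - θ by linarith), Φ.map_hom,
    LinearMap.comp_apply, Φ.inv_hom _ _ (by linarith), B.map_gen I _ (by linarith)]
  have h2 := B.coe_lt_death (show B.cappedDeath T K - (θ - η) < B.cappedDeath T K by linarith)
  split_ifs with h
  · subst h
    exact B.coord_gen_self I (by linarith) h2
  · exact B.coord_gen_of_ne h (by linarith) h2

open Classical in
/-- Hall's condition for the long bars of interleaved persistence modules: at least as many bars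
of the second module are close to one of them. -/
theorem card_le_card_close (Φ : Interleaving F G η) (hη : 0 ≤ η) (hηθ : η < θ) (hT : ∀ I, B.cappedDeath T I ≤ T) (hT' : ∀ J, B'.cappedDeath T J ≤ T)
    (A : Finset B.ι)
    (hA : ∀ I ∈ A, B.birth I + 2 * θ < B.cappedDeath T I) :
    A.card ≤ (Finset.univ.filter fun J : B'.ι => ∃ I ∈ A, |B.birth I - B'.birth J| ≤ θ ∧
      |B.cappedDeath T I - B'.cappedDeath T J| ≤ θ).card := by
  set N := Finset.univ.filter fun J : B'.ι => ∃ I ∈ A, |B.birth I - B'.birth J| ≤ θ ∧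
      |B.cappedDeath T I - B'.cappedDeath T J| ≤ θ
  have hmem : ∀ I ∈ A, ∀ J ∉ N, |B.birth I - B'.birth J| ≤ θ →
      ¬ |B.cappedDeath T I - B'.cappedDeath T J| ≤ θ := fun I hI J hJ h h' =>
    hJ (Finset.mem_filter.2 ⟨Finset.mem_univ J, I, hI, h, h'⟩)
  have hsum : ∀ I ∈ A, ∀ K ∈ A,
      B.birth I + B.cappedDeath T I ≤ B.birth K + B.cappedDeath T K →
      ∑ J ∈ N, B.invCoeff B' Φ T θ J K * B.homCoeff B' Φ θ I J =
        if I = K then 1 else 0 := by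
    intro I hI K hK hle
    have hI' := hA I hI
    have hK' := hA K hK
    rw [← B.sum_invCoeff_mul_homCoeff Φ hη hηθ (T := T) (I := I) (K := K) ?_]
    · refine Finset.sum_subset (Finset.subset_univ N) fun J _ hJ => ?_
      -- A bar `J` with nonzero contribution that is close to neither `I` nor `K` would force birth
      -- plus death of `K` to be strictly below that of `I`.
      by_contra hne
      obtain ⟨h1, h2⟩ := of_homCoeff_ne_zero Φ hη hηθ hT' (by linarith) (right_ne_zero_of_mul hne)
      obtain ⟨h3, h4⟩ := of_invCoeff_ne_zero Φ hη hηθ hT (by linarith) (left_ne_zero_of_mul hne)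
      have h5 := hmem I hI J hJ
      have h6 := hmem K hK J hJ
      simp only [abs_le] at h5 h6
      have h7 : B'.birth J < B.birth I - θ ∨ B'.cappedDeath T J < B.cappedDeath T I - θ := by
        by_contra! h
        exact h5 ⟨by linarith, by linarith⟩ ⟨by linarith, by linarith⟩
      have h8 : B.birth K + θ < B'.birth J ∨ B.cappedDeath T K + θ < B'.cappedDeath T J := by
        by_contra! h
        exact h6 ⟨by linarith, by linarith⟩ ⟨by linarith, by linarith⟩
      rcases h7 with h7 | h7 <;> rcases h8 with h8 | h8 <;> linarith
    · by_contra! h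
      linarith
  have hli : LinearIndependent k fun (I : A) (J : N) => B.homCoeff B' Φ θ I.1 J.1 := by
    rw [Fintype.linearIndependent_iff]
    intro c hc
    by_contra! hne
    -- Unitriangularity: in a linear relation take the `K` with nonzero coefficient and largest
    -- birth plus death. Pairing the relation with row `K` of the inverse matrix isolates that
    -- coefficient.
    obtain ⟨K, hK, hmax⟩ := (Finset.univ.filter fun I => c I ≠ 0).exists_max_image
      (fun I : A => B.birth I.1 + B.cappedDeath T I.1)
      (by obtain ⟨I, hI⟩ := hne; exact ⟨I, by simpa using hI⟩)
    have h0 : ∀ J : N, ∑ I, c I * B.homCoeff B' Φ θ I.1 J.1 = 0 := fun J => by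
      have := congrFun hc J
      simpa using this
    have h1 : ∑ I, c I * ∑ J ∈ N, B.invCoeff B' Φ T θ J K * B.homCoeff B' Φ θ I.1 J
        = 0 := by
      simp only [Finset.mul_sum]
      rw [Finset.sum_comm, ← Finset.sum_coe_sort]
      refine Finset.sum_eq_zero fun J _ => ?_
      have := congrArg (B.invCoeff B' Φ T θ J.1 K * ·) (h0 J)
      simp only [Finset.mul_sum, mul_zero] at this
      rw [← this]
      exact Finset.sum_congr rfl fun I _ => by ring
    rw [Finset.sum_eq_single K] at h1
    · rw [hsum K.1 K.2 K.1 K.2 le_rfl, if_pos rfl, mul_one] at h1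
      exact (Finset.mem_filter.1 hK).2 h1
    · intro I _ hIK
      by_cases hI : c I = 0
      · rw [hI, zero_mul]
      · rw [hsum I.1 I.2 K.1 K.2 (hmax I (by simpa using hI)),
          if_neg fun h => hIK (Subtype.ext h), mul_zero]
    · exact fun h => absurd (Finset.mem_univ K) h
  simpa using hli.fintype_card_le_finrank

end Interleaving

/-- The point of the extended plane given by a bar or by an additional point of the diagonal. -/
def diagramPoint : B.ι ⊕ ℚ → ExtPoint :=
  Sum.elim B.point fun q : ℚ => ((q : ℝ), ((q : ℝ) : WithTop ℝ))

theorem cappedDeath_cases (T : ℝ) (I : B.ι) :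
    B.death I = ⊤ ∧ B.cappedDeath T I = T ∨
      B.death I = B.cappedDeath T I ∧ B.cappedDeath T I ∈ B.ends := by
  have := @mem_ends_of_death_eq _ _ _ B I
  unfold cappedDeath
  generalize B.death I = d at this ⊢
  induction d with
  | top => exact Or.inl ⟨rfl, rfl⟩
  | coe d => exact Or.inr ⟨rfl, this rfl⟩

variable {B B'} {η θ : ℝ}

open Classical in
theorem exists_injective_pointDist_le (Φ : Interleaving F G η) (hη : 0 ≤ η) (hηθ : η < θ) :
    ∃ f : B.ι ⊕ ℚ → B'.ι ⊕ ℚ, Function.Injective f ∧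
      ∀ P, pointDist (B.diagramPoint P) (B'.diagramPoint (f P)) ≤ ENNReal.ofReal θ := by
  obtain ⟨M, hM⟩ := (B.ends ∪ B'.ends).bddAbove
  -- This cap is so large that infinite bars count as long and are never `θ`-close to finite ones.
  obtain ⟨T, hMT⟩ : ∃ T, T = M + 2 * θ + 1 := ⟨_, rfl⟩
  have hB : ∀ c ∈ B.ends, c + 2 * θ + 1 ≤ T := fun c hc => by
    linarith [hM (Finset.mem_union_left _ hc)]
  have hB' : ∀ c ∈ B'.ends, c + 2 * θ + 1 ≤ T := fun c hc => by
    linarith [hM (Finset.mem_union_right _ hc)]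
  have hT : ∀ I, B.cappedDeath T I ≤ T := fun I => by
    rcases B.cappedDeath_cases T I with h | h
    · exact h.2.le
    · linarith [hB _ h.2]
  have hT' : ∀ I, B'.cappedDeath T I ≤ T := fun I => by
    rcases B'.cappedDeath_cases T I with h | h
    · exact h.2.le
    · linarith [hB' _ h.2]
  have hlong : ∀ I, ¬ halfPersistence (B.point I) ≤ ENNReal.ofReal θ →
      B.birth I + 2 * θ < B.cappedDeath T I := fun I hI => by
    rcases B.cappedDeath_cases T I with h | h
    · rw [h.2]
      linarith [hB _ (B.birth_mem_ends I)]
    · by_contra! hle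
      apply hI
      rw [point, h.1]
      exact ENNReal.ofReal_le_ofReal (by linarith)
  have hclose : ∀ I J, |B.birth I - B'.birth J| ≤ θ →
      |B.cappedDeath T I - B'.cappedDeath T J| ≤ θ →
      pointDist (B.point I) (B'.point J) ≤ ENNReal.ofReal θ := fun I J h1 h2 => by
    refine (min_le_left _ _).trans (max_le (ENNReal.ofReal_le_ofReal h1) ?_)
    change extAbsSub (B.death I) (B'.death J) ≤ _
    rw [abs_le] at h2
    rcases B.cappedDeath_cases T I with h | h <;> rcases B'.cappedDeath_cases T J with h' | h'
    · rw [h.1, h'.1]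
      exact zero_le
    · linarith [hB' _ h'.2, h.2]
    · linarith [hB _ h.2, h'.2]
    · rw [h.1, h'.1]
      exact ENNReal.ofReal_le_ofReal (abs_le.2 h2)
  obtain ⟨g, hg, hg'⟩ := (Finset.all_card_le_biUnion_card_iff_exists_injective
    (fun I : {I : B.ι // ¬ halfPersistence (B.point I) ≤ ENNReal.ofReal θ} =>
      Finset.univ.filter fun J : B'.ι => |B.birth I - B'.birth J| ≤ θ ∧
        |B.cappedDeath T I - B'.cappedDeath T J| ≤ θ)).1 (fun s => by
      have := card_le_card_close Φ hη hηθ hT hT' (s.map (Function.Embedding.subtype _))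
        (fun I hI => by
          obtain ⟨I, -, rfl⟩ := Finset.mem_map.1 hI
          exact hlong I.1 I.2)
      rw [Finset.card_map] at this
      refine this.trans (Finset.card_le_card fun J hJ => ?_)
      obtain ⟨I, hI, h⟩ := (Finset.mem_filter.1 hJ).2
      obtain ⟨I, hI', rfl⟩ := Finset.mem_map.1 hI
      exact Finset.mem_biUnion.2 ⟨I, hI', Finset.mem_filter.2 ⟨Finset.mem_univ J, h⟩⟩)
  -- Short bars and diagonal points share the target diagonal. Any injection will do, as the cost
  -- does not depend on the diagonal point chosen.
  obtain ⟨c, hc⟩ : ∃ c : B.ι ⊕ ℚ → ℚ, Function.Injective c := by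
    obtain ⟨c, hc⟩ := exists_injective_nat (B.ι ⊕ ℚ)
    exact ⟨fun P => c P, Nat.cast_injective.comp hc⟩
  let f : B.ι ⊕ ℚ → B'.ι ⊕ ℚ := Sum.elim
    (fun I => if h : halfPersistence (B.point I) ≤ ENNReal.ofReal θ then Sum.inr (c (Sum.inl I))
      else Sum.inl (g ⟨I, h⟩)) fun q => Sum.inr (c (Sum.inr q))
  refine ⟨f, ?_, ?_⟩
  · rintro (I | q) (J | r) h <;> simp only [f, Sum.elim_inl, Sum.elim_inr] at h
    · split_ifs at h with h1 h2 h2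
      · exact hc (Sum.inr_injective h)
      · have := hg (Sum.inl_injective h)
        rw [Subtype.mk.injEq] at this
        rw [this]
    · split_ifs at h with h1
      exact hc (Sum.inr_injective h)
    · split_ifs at h with h1
      exact hc (Sum.inr_injective h)
    · exact hc (Sum.inr_injective h)
  · rintro (I | q)
    · simp only [f, Sum.elim_inl]
      split_ifs with h
      · exact pointDist_diagonal_le h _
      · have := (Finset.mem_filter.1 (hg' ⟨I, h⟩)).2
        exact hclose _ _ this.1 this.2
    · refine pointDist_diagonal_le ?_ _
      change ENNReal.ofReal (((q : ℝ) - q) / 2) ≤ _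
      simp

end Barcode

/-- The stability theorem for persistence diagrams. -/
theorem Interleaving.matchingDistance_le {F G : PersistenceModule.{v, w} k ℝ} {C D : Finset ℝ}
    (hF : F.IsConstructible C) (hG : G.IsConstructible D) {η : ℝ} (Φ : Interleaving F G η)
    (hη : 0 ≤ η) {ρ₁ ρ₂ : DeltaPlus → ℕ} (hρ₁ : ∀ s t (h : s < t), ρ₁ ⟨(s, t), h⟩ = F.rank s t)
    (hρ₂ : ∀ s t (h : s < t), ρ₂ ⟨(s, t), h⟩ = G.rank s t) :
    matchingDistance ρ₁ ρ₂ ≤ ENNReal.ofReal η := by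
  obtain ⟨B⟩ := hF.nonempty_barcode
  obtain ⟨B'⟩ := hG.nonempty_barcode
  obtain ⟨e, he⟩ := B.exists_diagram_equiv hF.finiteDimensional hρ₁
  obtain ⟨e', he'⟩ := B'.exists_diagram_equiv hG.finiteDimensional hρ₂
  refine ENNReal.le_of_forall_pos_le_add fun ε hε _ => ?_
  have hlt : η < η + ε := by simpa using hε
  obtain ⟨f, hf, hfd⟩ := Barcode.exists_injective_pointDist_le (B := B) (B' := B') Φ hη hlt
  obtain ⟨g, hg, hgd⟩ := Barcode.exists_injective_pointDist_le (B := B') (B' := B) Φ.symm hη hlt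
  -- The bijection uses only pairs from `f` or from `g`, so it inherits the bound on the cost.
  obtain ⟨σ, hσ, hσd⟩ := Function.Embedding.schroeder_bernstein_of_rel hf hg
    (fun P Q => pointDist (B.diagramPoint P) (B'.diagramPoint Q) ≤ ENNReal.ofReal (η + ε)) hfd
    fun P => by rw [pointDist_comm]; exact hgd P
  rw [← ENNReal.ofReal_coe_nnreal (p := ε), ← ENNReal.ofReal_add hη ε.coe_nonneg]
  refine iInf_le_of_le ((e.trans (Equiv.ofBijective σ hσ)).trans e'.symm) (iSup_le fun P => ?_)
  have h1 : P.point = B.diagramPoint (e P) := he P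
  have h2 : Diagram.point (((e.trans (Equiv.ofBijective σ hσ)).trans e'.symm) P) =
      B'.diagramPoint (σ (e P)) := by
    rw [he']
    simp [Barcode.diagramPoint]
  rw [h1, h2]
  exact hσd _

end PersistenceModule

/-! ### Persistent homology of sublevel sets -/

theorem le_of_abs_sub_le {X : Type u} {f g : X → ℝ} {η s t : ℝ} (h : ∀ P, |f P - g P| ≤ η) (hst : s + η ≤ t)
    (P : X) (hP : f P ≤ s) : g P ≤ t := by
  have := abs_le.1 (h P)
  linarith

theorem le_of_abs_sub_le' {X : Type u} {f g : X → ℝ} {η s t : ℝ} (h : ∀ P, |f P - g P| ≤ η) (hst : s + η ≤ t)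
    (P : X) (hP : g P ≤ s) : f P ≤ t := by
  have := abs_le.1 (h P)
  linarith

section SublevelSets

variable {X : Type u} [TopologicalSpace X]

/-- The inclusion of a lower level set of `f` in a lower level set of `g`. -/
def levelIncl {f g : X → ℝ} {s t : ℝ} (h : ∀ P, f P ≤ s → g P ≤ t) :
    lowerLevel f s ⟶ lowerLevel g t :=
  TopCat.ofHom
    { toFun := fun P => ⟨P.1, h P.1 P.2⟩
      continuous_toFun := by fun_prop }

variable (k : Type v) [Field k] (i : ℤ)

/-- The map in homology induced by an inclusion of lower level sets. -/
def levelMap {f g : X → ℝ} {s t : ℝ} (h : ∀ P, f P ≤ s → g P ≤ t) :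
    (singularHomology.{u, v} k i).obj (lowerLevel f s) →ₗ[k]
      (singularHomology.{u, v} k i).obj (lowerLevel g t) :=
  ((singularHomology.{u, v} k i).map (levelIncl h)).hom

theorem levelMap_levelMap {f₁ f₂ f₃ : X → ℝ} {r s t : ℝ} (h : ∀ P, f₁ P ≤ r → f₂ P ≤ s)
    (h' : ∀ P, f₂ P ≤ s → f₃ P ≤ t)
    (v : (singularHomology.{u, v} k i).obj (lowerLevel f₁ r)) :
    levelMap k i h' (levelMap k i h v) = levelMap k i (fun P hP => h' P (h P hP)) v := by
  have h1 : levelIncl h ≫ levelIncl h' = levelIncl fun P hP => h' P (h P hP) := rfl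
  unfold levelMap
  rw [← h1, Functor.map_comp]
  rfl

theorem levelMap_refl {f : X → ℝ} {s : ℝ} (h : ∀ P, f P ≤ s → f P ≤ s)
    (v : (singularHomology.{u, v} k i).obj (lowerLevel f s)) : levelMap k i h v = v := by
  have h1 : levelIncl h = 𝟙 (lowerLevel f s) := rfl
  unfold levelMap
  rw [h1, CategoryTheory.Functor.map_id]
  rfl

/-- The persistent homology of a real function. -/
def persistentHomology (f : X → ℝ) : PersistenceModule.{v, max u v} k ℝ where
  V t := (singularHomology.{u, v} k i).obj (lowerLevel f t)
  map h := persistenceMap k f i h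
  map_refl _ v := levelMap_refl k i (fun _ hP => hP) v
  map_map h h' v :=
    levelMap_levelMap k i (fun _ hP => hP.trans h) (fun _ hP => hP.trans h') v

theorem rankInvariant_eq (f : X → ℝ) (s t : ℝ) (h : s < t) :
    rankInvariant k f i ⟨(s, t), h⟩ = (persistentHomology k i f).rank s t :=
  ((persistentHomology k i f).rank_eq h.le).symm

/-- The persistent homology of a tame function that is bounded below is constructible. -/
theorem Tame.isConstructible {f : X → ℝ} (hf : Tame k f) (hb : BddBelow (Set.range f)) :
    (persistentHomology k i f).IsConstructible hf.finite_critical.toFinset where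
  finiteDimensional := hf.finite_dimensional i
  regular := by
    intro a ha ε₀ hε₀
    rw [Set.Finite.mem_toFinset] at ha
    -- A failure of regularity in the fixed degree `i` is exactly what makes `a` critical.
    by_contra! h
    exact ha ⟨i, ε₀, hε₀, fun ε hε hε' => h ε hε hε'⟩
  subsingleton := by
    obtain ⟨T, hT⟩ := hb
    refine ⟨T, fun t ht => ?_⟩
    have : IsEmpty (lowerLevel f t) := ⟨fun P => by
      have := hT ⟨P.1, rfl⟩
      linarith [P.2]⟩
    exact subsingleton_singularHomology_of_isEmpty k i (lowerLevel f t)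

/-- Functions at distance at most `η` have `η`-interleaved persistent homology. -/
def interleavingOfDistLe {f g : X → ℝ} {η : ℝ} (h : ∀ P, |f P - g P| ≤ η) :
    PersistenceModule.Interleaving (persistentHomology.{u, v} k i f) (persistentHomology k i g) η where
  hom hst := levelMap k i (le_of_abs_sub_le h hst)
  inv hst := levelMap k i (le_of_abs_sub_le' h hst)
  map_hom h₁ h₂ v := levelMap_levelMap k i (le_of_abs_sub_le h h₁) (fun _ hP => hP.trans h₂) v
  hom_map h₁ h₂ _ v := levelMap_levelMap k i (fun _ hP => hP.trans h₁) (le_of_abs_sub_le h h₂) v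
  map_inv h₁ h₂ v := levelMap_levelMap k i (le_of_abs_sub_le' h h₁) (fun _ hP => hP.trans h₂) v
  inv_map h₁ h₂ _ v := levelMap_levelMap k i (fun _ hP => hP.trans h₁) (le_of_abs_sub_le' h h₂) v
  inv_hom h₁ h₂ _ v := levelMap_levelMap k i (le_of_abs_sub_le h h₁) (le_of_abs_sub_le' h h₂) v
  hom_inv h₁ h₂ _ v := levelMap_levelMap k i (le_of_abs_sub_le' h h₁) (le_of_abs_sub_le h h₂) v

end SublevelSets

/-- The stability theorem for tame functions. -/
theorem Tame.matchingDistance_le (k : Type v) [Field k] {X : Type u} [TopologicalSpace X]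
    {f g : X → ℝ} (hf : Tame k f) (hg : Tame k g) (hfb : BddBelow (Set.range f))
    (hgb : BddBelow (Set.range g)) {η : ℝ} (hη : 0 ≤ η) (h : ∀ P, |f P - g P| ≤ η) (i : ℤ) :
    matchingDistance (rankInvariant k f i) (rankInvariant k g i) ≤ ENNReal.ofReal η :=
  (interleavingOfDistLe k i h).matchingDistance_le (hf.isConstructible k i hfb)
    (hg.isConstructible k i hgb) hη (rankInvariant_eq k i f) (rankInvariant_eq k i g)

/-! ### Reduced functions of nearby maps -/

section Reduced

variable {X : Type u} {n : ℕ} {l b : EuclideanSpace ℝ (Fin n)}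

theorem Admissible.nonempty (h : Admissible l b) : Nonempty (Fin n) := by
  by_contra hn
  rw [not_nonempty_iff] at hn
  have := h.norm_eq_one
  rw [Subsingleton.elim l 0, norm_zero] at this
  exact zero_ne_one this

theorem Admissible.iInf_pos (h : Admissible l b) : 0 < ⨅ j, l j := by
  have := h.nonempty
  obtain ⟨j, hj⟩ := exists_eq_ciInf_of_finite (f := fun j => l j)
  exact hj ▸ h.pos j

theorem reduced_le_add (h : Admissible l b) {f g : X → Fin n → ℝ} {ε : ℝ} (P : X)
    (hP : ‖f P - g P‖ ≤ ε) :
    reduced l b f P ≤ reduced l b g P + ε / ⨅ j, l j := by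
  have := h.nonempty
  refine ciSup_le fun j => ?_
  have h1 : (g P j - b j) / l j ≤ reduced l b g P :=
    le_ciSup (f := fun j => (g P j - b j) / l j) (Set.finite_range _).bddAbove j
  have h2 : f P j - g P j ≤ ε :=
    (le_abs_self _).trans ((norm_le_pi_norm (f P - g P) j).trans hP)
  have h3 : (⨅ j, l j) ≤ l j := ciInf_le (Set.finite_range _).bddBelow j
  have h4 : ε / l j ≤ ε / ⨅ j, l j :=
    div_le_div_of_nonneg_left ((norm_nonneg _).trans hP) h.iInf_pos h3
  have h5 : (f P j - g P j) / l j ≤ ε / l j := div_le_div_of_nonneg_right h2 (h.pos j).le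
  have h6 : (f P j - b j) / l j = (g P j - b j) / l j + (f P j - g P j) / l j := by
    rw [← add_div]
    congr 1
    ring
  linarith

theorem abs_reduced_sub_le (h : Admissible l b) {f g : X → Fin n → ℝ} {ε : ℝ} (P : X)
    (hP : ‖f P - g P‖ ≤ ε) : |reduced l b f P - reduced l b g P| ≤ ε / ⨅ j, l j := by
  have h1 := reduced_le_add h P hP
  have h2 := reduced_le_add h P (norm_sub_rev (f P) (g P) ▸ hP)
  exact abs_le.2 ⟨by linarith, by linarith⟩

theorem bddBelow_range_reduced [TopologicalSpace X] [CompactSpace X] (h : Admissible l b)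
    {f : X → Fin n → ℝ} (hf : Continuous f) : BddBelow (Set.range (reduced l b f)) := by
  obtain ⟨j⟩ := h.nonempty
  have hc : Continuous fun P => (f P j - b j) / l j := by fun_prop
  obtain ⟨M, hM⟩ := (isCompact_range hc).bddBelow
  refine ⟨M, ?_⟩
  rintro _ ⟨P, rfl⟩
  exact (hM ⟨P, rfl⟩).trans
    (le_ciSup (f := fun j => (f P j - b j) / l j) (Set.finite_range _).bddAbove j)

end Reduced

end MultiPersistence

end

theorem proposition4p3 (k : Type v) [Field k]
    (X : Type u) [TopologicalSpace X] [Nonempty X] [CompactSpace X] [LocallyConnectedSpace X]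
    [T2Space X] (n : ℕ) (f' f'' : X → Fin n → ℝ)
    (hf' : MultiPersistence.MaxTame k f') (hf'' : MultiPersistence.MaxTame k f'')
    (ε : ℝ) (hε : ∀ P : X, ‖f' P - f'' P‖ ≤ ε)
    (l b : EuclideanSpace ℝ (Fin n)) (hlb : MultiPersistence.Admissible l b) (i : ℤ) :
    MultiPersistence.matchingDistance
        (MultiPersistence.rankInvariant k (MultiPersistence.reduced l b f') i)
        (MultiPersistence.rankInvariant k (MultiPersistence.reduced l b f'') i)
      ≤ ENNReal.ofReal (ε / ⨅ j, l j) := by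
  obtain ⟨P⟩ := ‹Nonempty X›
  exact MultiPersistence.Tame.matchingDistance_le k (hf'.tame l b hlb) (hf''.tame l b hlb)
    (MultiPersistence.bddBelow_range_reduced hlb hf'.continuous)
    (MultiPersistence.bddBelow_range_reduced hlb hf''.continuous)
    (div_nonneg ((norm_nonneg _).trans (hε P)) hlb.iInf_pos.le)
    (fun P => MultiPersistence.abs_reduced_sub_le hlb P (hε P)) i
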